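/- All simplices below are full-dimensional lattice simplices \(\Delta=\operatorname{conv}(\mathbf v_0,\dots,\mathbf v_5)\subset\mathbb R^5\) with \(\mathbf v_i\in\mathbb Z^5\). Two polytopes \(P,Q\subset\mathbb R^d\) are unimodularly equivalent if \(Q=\{\mathbf xU+\mathbf w:\mathbf x\in P\}\) for some \(U\in\mathbb Z^{d\times d}\) with \(\det U=\pm1\) and some \(\mathbf w\in\mathbb Z^d\). The simplex \(\Delta\) is Gorenstein if, for some integer \(r\ge1\), \(r\Delta\) is unimodularly equivalent to a reflexive polytope, i.e. a lattice polytope with \(\mathbf 0\) in its interior whose dual polytope \(\{\mathbf y:\langle \mathbf x,\mathbf y\rangle\le1\ \forall \mathbf x\}\) is a lattice polytope. Its degree is \(6-\min\{n\ge1:\operatorname{int}(n\Delta)\cap\mathbb Z^5\ne\emptyset\}\), and its \(h^*\)-polynomial is \(h^*(\Delta,t)=(1-t)^6\bigl(1+\sum_{k\ge1}|k\Delta\cap\mathbb Z^5|\,t^k\bigr)\). It is a lattice pyramid if it is unimodularly equivalent to \(\operatorname{conv}(Q\times\{0\},(0,0,0,0,1))\) for some lattice polytope \(Q\subset\mathbb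 R^4\). Let \(\Lambda_\Delta=\{x\in[0,1)^6:\sum_i x_i(\mathbf v_i,1)\in\mathbb Z^6\}\), and let \(G_\Delta\) be the graph on the six indices \(0,\dots,5\) in which \(i\ne j\) are adjacent if and only if the vector with coordinates \(i,j\) equal to \(\tfrac12\) and all others \(0\) lies in \(\Lambda_\Delta\). **Theorem.** There are exactly \(6\) unimodular equivalence classes of \(5\)-dimensional Gorenstein simplices of degree \(3\) that are not lattice pyramids. Each of the following six simplices is such a simplex, and has the stated graph \(G_\Delta\) (up to isomorphism, omitting isolated vertices) and \(h^*\)-polynomial; every \(5\)-dimensional Gorenstein simplex of degree \(3\) that is not a lattice pyramid is unimodularly equivalent to exactly one of them: 1. \(G_\Delta\cong\emptyset\), \(h^*=1+t^3\): vertices \(\mathbf 0,\mathbf e_1,\mathbf e_2,\mathbf e_3,\mathbf e_4,\mathbf e_1+\mathbf e_2+\mathbf e_3+\mathbf e_4+2\mathbf e_5\); 2. \(G_\Delta\cong K_2\), \(h^*=1+t+t^2+t^3\): vertices \(\mathbf 0,\mathbf e_1,\mathbf e_2,\mathbf e_3,2\mathbf e_4,\mathbf e_1+\mathbf e_2+\mathbf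 e_3+2\mathbf e_5\); 3. \(G_\Delta\cong K_3\), \(h^*=1+3t+3t^2+t^3\): vertices \(\mathbf 0,\mathbf e_1,\mathbf e_2,2\mathbf e_3,2\mathbf e_4,\mathbf e_1+\mathbf e_2+2\mathbf e_5\); 4. \(G_\Delta\cong 3K_2\), \(h^*=1+3t+3t^2+t^3\): vertices \(\mathbf 0,\mathbf e_1,\mathbf e_2,2\mathbf e_3,\mathbf e_2+2\mathbf e_4,\mathbf e_1+2\mathbf e_5\); 5. \(G_\Delta\cong K_4\sqcup K_2\), \(h^*=1+7t+7t^2+t^3\): vertices \(\mathbf 0,\mathbf e_1,2\mathbf e_2,2\mathbf e_3,2\mathbf e_4,\mathbf e_1+2\mathbf e_5\); 6. \(G_\Delta\cong K_6\), \(h^*=1+15t+15t^2+t^3\): vertices \(\mathbf 0,2\mathbf e_1,2\mathbf e_2,2\mathbf e_3,2\mathbf e_4,2\mathbf e_5\). Moreover, a \(5\)-dimensional Gorenstein simplex \(\Delta\) of degree \(3\) that is not a lattice pyramid is unimodularly equivalent to the \(i\)-th simplex of the list if and only if \(G_\Delta\) is isomorphic to the \(i\)-th graph, and then \(h^*(\Delta,t)\)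 is the \(i\)-th polynomial. -/

import Mathlib

open scoped Pointwise

/-- The coordinatewise inclusion of `ℤ^d` into `ℝ^d`. -/
def intVec {d : ℕ} (z : Fin d → ℤ) : Fin d → ℝ := fun i => (z i : ℝ)

/-- The lattice `ℤ^d` as a subset of `ℝ^d`. -/
def intLattice (d : ℕ) : Set (Fin d → ℝ) := Set.range intVec

/-- A lattice polytope: the convex hull of a nonempty finite set of lattice points. -/
def IsLatticePolytope {d : ℕ} (P : Set (Fin d → ℝ)) : Prop :=
  ∃ V : Finset (Fin d → ℤ), V.Nonempty ∧ P = convexHull ℝ (intVec '' (V : Set (Fin d → ℤ)))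

/-- Unimodular equivalence: `Q` is the image of `P` under `x ↦ x U + w` with an integer matrix `U`
of determinant `±1` and a lattice vector `w`. -/
def UnimodularEquiv {d : ℕ} (P Q : Set (Fin d → ℝ)) : Prop :=
  ∃ (U : Matrix (Fin d) (Fin d) ℤ) (w : Fin d → ℤ), IsUnit U.det ∧
    Q = (fun x : Fin d → ℝ => Matrix.vecMul x (U.map (Int.cast : ℤ → ℝ)) + intVec w) '' P

theorem UnimodularEquiv.refl {d : ℕ} (P : Set (Fin d → ℝ)) : UnimodularEquiv P P := by
  refine ⟨1, 0, by simp, ?_⟩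
  have h : (intVec (0 : Fin d → ℤ)) = 0 := by ext i; simp [intVec]
  simp [h]

theorem intVec_vecMul {d : ℕ} (w : Fin d → ℤ) (U : Matrix (Fin d) (Fin d) ℤ) :
    Matrix.vecMul (intVec w) (U.map (Int.cast : ℤ → ℝ)) = intVec (Matrix.vecMul w U) := by
  ext i
  simp [intVec, Matrix.vecMul, dotProduct]

theorem map_cast_mul {d : ℕ} (U V : Matrix (Fin d) (Fin d) ℤ) :
    (U * V).map (Int.cast : ℤ → ℝ) = U.map (Int.cast : ℤ → ℝ) * V.map (Int.cast : ℤ → ℝ) :=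
  Matrix.map_mul (f := Int.castRingHom ℝ)

theorem UnimodularEquiv.trans {d : ℕ} {P Q R : Set (Fin d → ℝ)} (h₁ : UnimodularEquiv P Q)
    (h₂ : UnimodularEquiv Q R) : UnimodularEquiv P R := by
  obtain ⟨U, w, hU, rfl⟩ := h₁
  obtain ⟨V, z, hV, rfl⟩ := h₂
  refine ⟨U * V, Matrix.vecMul w V + z, by rw [Matrix.det_mul]; exact hU.mul hV, ?_⟩
  rw [Set.image_image]
  refine Set.image_congr fun x _ => ?_
  have h : intVec (Matrix.vecMul w V + z) = intVec (Matrix.vecMul w V) + intVec z := by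
    ext i; simp [intVec]
  rw [Matrix.add_vecMul, Matrix.vecMul_vecMul, ← map_cast_mul, intVec_vecMul, h, add_assoc]

theorem UnimodularEquiv.symm {d : ℕ} {P Q : Set (Fin d → ℝ)} (h : UnimodularEquiv P Q) :
    UnimodularEquiv Q P := by
  obtain ⟨U, w, hU, rfl⟩ := h
  have hmul : U * U⁻¹ = 1 := Matrix.mul_nonsing_inv U hU
  refine ⟨U⁻¹, -Matrix.vecMul w U⁻¹, Matrix.isUnit_nonsing_inv_det U hU, ?_⟩
  rw [Set.image_image]
  have h : intVec (-Matrix.vecMul w U⁻¹) = -intVec (Matrix.vecMul w U⁻¹) := by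
    ext i; simp [intVec]
  have key : ∀ x : Fin d → ℝ, Matrix.vecMul (Matrix.vecMul x (U.map (Int.cast : ℤ → ℝ)) + intVec w)
      (U⁻¹.map (Int.cast : ℤ → ℝ)) + intVec (-Matrix.vecMul w U⁻¹) = x := by
    intro x
    rw [Matrix.add_vecMul, Matrix.vecMul_vecMul, ← map_cast_mul, intVec_vecMul, h, hmul]
    simp
  simp only [key, Set.image_id']

/-- The dual polytope `{y : ⟨x, y⟩ ≤ 1 for all x ∈ P}`. -/
def dualPolytope {d : ℕ} (P : Set (Fin d → ℝ)) : Set (Fin d → ℝ) :=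
  {y | ∀ x ∈ P, x ⬝ᵥ y ≤ 1}

/-- Reflexive polytopes. -/
def IsReflexive {d : ℕ} (P : Set (Fin d → ℝ)) : Prop :=
  IsLatticePolytope P ∧ (0 : Fin d → ℝ) ∈ interior P ∧ IsLatticePolytope (dualPolytope P)

/-- `P` is Gorenstein of index `r` if `r P` is unimodularly equivalent to a reflexive polytope. -/
def IsGorensteinOfIndex {d : ℕ} (P : Set (Fin d → ℝ)) (r : ℕ) : Prop :=
  0 < r ∧ ∃ Q : Set (Fin d → ℝ), IsReflexive Q ∧ UnimodularEquiv ((r : ℝ) • P) Q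

/-- A Gorenstein polytope: Gorenstein of some positive index. -/
def IsGorenstein {d : ℕ} (P : Set (Fin d → ℝ)) : Prop := ∃ r : ℕ, IsGorensteinOfIndex P r

/-- The codegree of a full-dimensional polytope: the least `n ≥ 1` such that the interior of `n P`
contains a lattice point. -/
noncomputable def codegree {d : ℕ} (P : Set (Fin d → ℝ)) : ℕ :=
  sInf {n : ℕ | 0 < n ∧ (interior ((n : ℝ) • P) ∩ intLattice d).Nonempty}

/-- The degree `d + 1 - codeg P` of a full-dimensional polytope `P ⊆ ℝ^d`. -/
noncomputable def polytopeDegree {d : ℕ} (P : Set (Fin d → ℝ)) : ℤ :=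
  (d : ℤ) + 1 - (codegree P : ℤ)

/-- `Pyr(P) = conv(P × {0}, (0, …, 0, 1)) ⊆ ℝ^(d+1)`. -/
def pyramid {d : ℕ} (P : Set (Fin d → ℝ)) : Set (Fin (d + 1) → ℝ) :=
  convexHull ℝ (((fun x : Fin d → ℝ => (Fin.snoc x 0 : Fin (d + 1) → ℝ)) '' P) ∪
    {(Fin.snoc (0 : Fin d → ℝ) 1 : Fin (d + 1) → ℝ)})

/-- `P ⊆ ℝ^(d+1)` is a lattice pyramid if it is, up to unimodular equivalence, the pyramid over a
lattice polytope in `ℝ^d` (which may itself be a lattice pyramid, so that iterated pyramids are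
covered). -/
def IsLatticePyramid {d : ℕ} (P : Set (Fin (d + 1) → ℝ)) : Prop :=
  ∃ Q : Set (Fin d → ℝ), IsLatticePolytope Q ∧ UnimodularEquiv (pyramid Q) P

/-- The lattice point enumerator `L_P(k) = |k P ∩ ℤ^d|`. -/
noncomputable def latticeCount {d : ℕ} (P : Set (Fin d → ℝ)) (k : ℕ) : ℕ :=
  (((k : ℝ) • P) ∩ intLattice d).ncard

/-- The Ehrhart series `1 + ∑_{k ≥ 1} L_P(k) t^k`. -/
noncomputable def ehrhartSeries {d : ℕ} (P : Set (Fin d → ℝ)) : PowerSeries ℤ :=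
  PowerSeries.mk fun k => if k = 0 then 1 else (latticeCount P k : ℤ)

/-- `h^*(P, t) = (1 - t)^(d+1) Ehr_P(t)` for a full-dimensional `P ⊆ ℝ^d`, as a formal power series
(it is a polynomial when `P` is a `d`-dimensional lattice polytope). -/
noncomputable def hStar {d : ℕ} (P : Set (Fin d → ℝ)) : PowerSeries ℤ :=
  (1 - PowerSeries.X) ^ (d + 1) * ehrhartSeries P

/-- A `d`-dimensional lattice simplex in `ℝ^d`, with an enumeration of its vertices. -/
structure LatticeSimplex (d : ℕ) where
  /-- the vertices `v_0, …, v_d` -/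
  vertex : Fin (d + 1) → Fin d → ℤ
  affineIndependent : AffineIndependent ℝ fun i => intVec (vertex i)

namespace LatticeSimplex

/-- The simplex as a subset of `ℝ^d`. -/
def polytope {d : ℕ} (Δ : LatticeSimplex d) : Set (Fin d → ℝ) :=
  convexHull ℝ (Set.range fun i => intVec (Δ.vertex i))

/-- The associated group `Λ_Δ = {x ∈ [0,1)^(d+1) : ∑ x_i (v_i, 1) ∈ ℤ^(d+1)}` (as a set). -/
def assocGroup {d : ℕ} (Δ : LatticeSimplex d) : Set (Fin (d + 1) → ℝ) :=
  {x | (∀ i, x i ∈ Set.Ico (0 : ℝ) 1) ∧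
    ∑ i, x i • (Fin.snoc (intVec (Δ.vertex i)) 1 : Fin (d + 1) → ℝ) ∈ intLattice (d + 1)}

/-- `H_k`, the elements of `Λ_Δ` of height `∑ x_i = k`. -/
def heightLayer {d : ℕ} (Δ : LatticeSimplex d) (k : ℕ) : Set (Fin (d + 1) → ℝ) :=
  {x | x ∈ Δ.assocGroup ∧ ∑ i, x i = (k : ℝ)}

/-- The vector `ε_ij`: coordinates `i` and `j` are `1/2`, all others are `0`. -/
noncomputable def halfVec {d : ℕ} (i j : Fin (d + 1)) : Fin (d + 1) → ℝ :=
  fun k => if k = i ∨ k = j then 1 / 2 else 0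

/-- The graph `G_Δ` on the index set of the vertices: `i ≠ j` are adjacent iff `ε_ij ∈ H_1`. -/
noncomputable def graph {d : ℕ} (Δ : LatticeSimplex d) : SimpleGraph (Fin (d + 1)) where
  Adj i j := i ≠ j ∧ halfVec i j ∈ Δ.heightLayer 1
  symm := ⟨fun i j h => by
    refine ⟨h.1.symm, ?_⟩
    have e : (halfVec j i : Fin (d + 1) → ℝ) = halfVec i j := by
      funext k; simp only [halfVec, or_comm]
    rw [e]; exact h.2⟩
  loopless := ⟨fun _ h => h.1 rfl⟩

/-- `Δ` is a `5`-dimensional Gorenstein simplex of degree `3` that is not a lattice pyramid. -/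
def IsNonpyramidalGorensteinDegreeThree (Δ : LatticeSimplex 5) : Prop :=
  IsGorenstein Δ.polytope ∧ polytopeDegree Δ.polytope = 3 ∧ ¬ IsLatticePyramid Δ.polytope

/-- Unimodular equivalence on the `5`-dimensional Gorenstein simplices of degree `3` that are not
lattice pyramids (the order of the vertices plays no role). -/
def degreeThreeSetoid : Setoid {Δ : LatticeSimplex 5 // Δ.IsNonpyramidalGorensteinDegreeThree} where
  r Δ Δ' := UnimodularEquiv Δ.1.polytope Δ'.1.polytope
  iseqv := ⟨fun _ => UnimodularEquiv.refl _, fun h => h.symm, fun h h' => h.trans h'⟩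

/-- Lattice points `v_0, …, v_d` are affinely independent if the matrix with rows `(v_i, 1)`
has nonzero determinant. -/
theorem affineIndependent_of_det {d : ℕ} (v : Fin (d + 1) → Fin d → ℤ)
    (h : (Matrix.of fun i => (Fin.snoc (v i) 1 : Fin (d + 1) → ℤ)).det ≠ 0) :
    AffineIndependent ℝ fun i => intVec (v i) := by
  rw [affineIndependent_iff]
  intro s w hw hsum i hi
  by_contra hne
  apply h
  have hdet : ((Matrix.of fun i => (Fin.snoc (v i) 1 : Fin (d + 1) → ℤ)).map
      (Int.castRingHom ℝ)).det = 0 := by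
    apply Matrix.exists_vecMul_eq_zero_iff.mp
    refine ⟨fun j => if j ∈ s then w j else 0, fun h0 => hne ?_, ?_⟩
    · simpa [hi] using congrFun h0 i
    · funext k
      refine Fin.lastCases ?_ (fun k => ?_) k
      · simpa [Matrix.vecMul, dotProduct] using hw
      · simpa [Matrix.vecMul, dotProduct, intVec, Finset.sum_apply] using congrFun hsum k
  have hcast := RingHom.map_det (Int.castRingHom ℝ)
    (Matrix.of fun i => (Fin.snoc (v i) 1 : Fin (d + 1) → ℤ))
  rw [RingHom.mapMatrix_apply, hdet] at hcast
  simpa using hcast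

/-- The vertices of the six simplices of the classification, one row per vertex. -/
def tableVertex : Fin 6 → Fin 6 → Fin 5 → ℤ :=
  ![ -- `0, e₁, e₂, e₃, e₄, e₁ + e₂ + e₃ + e₄ + 2e₅`
    ![![0,0,0,0,0], ![1,0,0,0,0], ![0,1,0,0,0], ![0,0,1,0,0], ![0,0,0,1,0], ![1,1,1,1,2]],
    -- `0, e₁, e₂, e₃, 2e₄, e₁ + e₂ + e₃ + 2e₅`
    ![![0,0,0,0,0], ![1,0,0,0,0], ![0,1,0,0,0], ![0,0,1,0,0], ![0,0,0,2,0], ![1,1,1,0,2]],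
    -- `0, e₁, e₂, 2e₃, 2e₄, e₁ + e₂ + 2e₅`
    ![![0,0,0,0,0], ![1,0,0,0,0], ![0,1,0,0,0], ![0,0,2,0,0], ![0,0,0,2,0], ![1,1,0,0,2]],
    -- `0, e₁, e₂, 2e₃, e₂ + 2e₄, e₁ + 2e₅`
    ![![0,0,0,0,0], ![1,0,0,0,0], ![0,1,0,0,0], ![0,0,2,0,0], ![0,1,0,2,0], ![1,0,0,0,2]],
    -- `0, e₁, 2e₂, 2e₃, 2e₄, e₁ + 2e₅`
    ![![0,0,0,0,0], ![1,0,0,0,0], ![0,2,0,0,0], ![0,0,2,0,0], ![0,0,0,2,0], ![1,0,0,0,2]],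
    -- `0, 2e₁, 2e₂, 2e₃, 2e₄, 2e₅`
    ![![0,0,0,0,0], ![2,0,0,0,0], ![0,2,0,0,0], ![0,0,2,0,0], ![0,0,0,2,0], ![0,0,0,0,2]]]

theorem tableVertex_det (i : Fin 6) :
    (Matrix.of fun j => (Fin.snoc (tableVertex i j) 1 : Fin 6 → ℤ)).det ≠ 0 := by
  revert i
  decide +kernel

/-- The six simplices of the classification. -/
def tableSimplex (i : Fin 6) : LatticeSimplex 5 where
  vertex := tableVertex i
  affineIndependent := affineIndependent_of_det _ (tableVertex_det i)

/-- The disjoint union of the complete graphs on the fibres of `b` (the blocks of a partition). -/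
def cliqueUnion (b : Fin 6 → ℕ) : SimpleGraph (Fin 6) where
  Adj i j := i ≠ j ∧ b i = b j
  symm := ⟨fun _ _ h => ⟨h.1.symm, h.2.symm⟩⟩
  loopless := ⟨fun _ h => h.1 rfl⟩

/-- The graphs `∅, K₂, K₃, 3K₂, K₄ ⊔ K₂, K₆` on six vertices (the remaining vertices of `K₂` and
`K₃` being isolated). -/
def tableGraph : Fin 6 → SimpleGraph (Fin 6) :=
  ![cliqueUnion ![0,1,2,3,4,5],
    cliqueUnion ![0,0,1,2,3,4],
    cliqueUnion ![0,0,0,1,2,3],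
    cliqueUnion ![0,0,1,1,2,2],
    cliqueUnion ![0,0,0,0,1,1],
    cliqueUnion ![0,0,0,0,0,0]]

open Polynomial in
/-- The `h^*`-polynomials of the six simplices. -/
noncomputable def tableHStar : Fin 6 → ℤ[X] :=
  ![1 + X ^ 3,
    1 + X + X ^ 2 + X ^ 3,
    1 + 3 * X + 3 * X ^ 2 + X ^ 3,
    1 + 3 * X + 3 * X ^ 2 + X ^ 3,
    1 + 7 * X + 7 * X ^ 2 + X ^ 3,
    1 + 15 * X + 15 * X ^ 2 + X ^ 3]

end LatticeSimplex

/-! Let `M` be the matrix with rows `(v_i, 1)`. The heart of the matter is that a simplex is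
Gorenstein of degree 3 and not a lattice pyramid exactly when it satisfies `IsHalfIntegral`: `M`
divides `2` over the integers, and half the sum of its rows is integral.

Necessity: let `p` be the lattice point of `rΔ` around which it is reflexive, with barycentric
coordinates `β_i` of sum `r`. Duality gives for each facet an integral affine functional with value
`1` at `(p, r)` that vanishes at all vertices but the opposite one, where it takes a value `m_i`; so
`m_i β_i = 1`. If `m_i = 1` then `Δ` is a pyramid with apex `v_i`, so `β_i ≤ 1/2`. Six such numbers
add up to `r ≥ codeg Δ = 3`, so all are `1/2` and all `m_i` are `2`. Sufficiency is a direct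
computation with the point `(1/2, …, 1/2)`.

Thus `2Λ_Δ` is, modulo 2, a binary code of length six: the linear relations among the rows of `M`
modulo 2. It is even, because the rows end in `1`, and contains the all-ones word. Words of weight 4
are complements of words of weight 2, so the code is determined by its words of weight 2, which are
the edges of `G_Δ`; and the code determines the simplex up to equivalence
(`unimodularEquiv_of_graph_iso`).

Adjacency is congruence of vertices modulo 2, so `G_Δ` is a disjoint union of cliques, and the
all-ones word forces the complement of two disjoint edges to be an edge. The partitions of six
points allowed by this have types 1⁶, 21⁴, 31³, 2³, 42 and 6. Finally `h^*` is the weight enumerator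
of the code, with `t` to half the weight. -/

open Matrix

/-! ### Homogeneous and barycentric coordinates -/

/-- The homogeneous coordinates `(x, k)` of the point `x` at height `k`. -/
def homVec {R : Type*} {d : ℕ} (x : Fin d → R) (k : R) : Fin (d + 1) → R := Fin.snoc x k

@[simp] theorem homVec_castSucc {R : Type*} {d : ℕ} (x : Fin d → R) (k : R) (i : Fin d) :
    homVec x k i.castSucc = x i := by simp [homVec]

@[simp] theorem homVec_last {R : Type*} {d : ℕ} (x : Fin d → R) (k : R) :
    homVec x k (Fin.last d) = k := by simp [homVec]

theorem homVec_ext {R : Type*} {d : ℕ} {a b : Fin (d + 1) → R}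
    (h : ∀ i : Fin d, a i.castSucc = b i.castSucc) (h' : a (Fin.last d) = b (Fin.last d)) :
    a = b := by
  funext i
  induction i using Fin.lastCases with
  | last => exact h'
  | cast i => exact h i

theorem homVec_combination {R : Type*} [Ring R] {d : ℕ} (a b : R) (x y : Fin d → R) (k l : R) :
    homVec (a • x + b • y) (a * k + b * l) = a • homVec x k + b • homVec y l :=
  homVec_ext (by simp) (by simp)

theorem homVec_intVec {d : ℕ} (z : Fin d → ℤ) (k : ℤ) :
    homVec (intVec z) (k : ℝ) = intVec (homVec z k) :=
  homVec_ext (by simp [intVec]) (by simp [intVec])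

namespace LatticeSimplex

variable {d : ℕ} (Δ : LatticeSimplex d)

/-- The integer matrix with rows `(v_i, 1)`. -/
def homMatrix : Matrix (Fin (d + 1)) (Fin (d + 1)) ℤ := Matrix.of fun i => homVec (Δ.vertex i) 1

/-- The matrix with rows `(v_i, 1)` over the reals. -/
def realMatrix : Matrix (Fin (d + 1)) (Fin (d + 1)) ℝ := Δ.homMatrix.map (Int.cast : ℤ → ℝ)

@[simp] theorem homMatrix_castSucc (i : Fin (d + 1)) (j : Fin d) :
    Δ.homMatrix i j.castSucc = Δ.vertex i j := by simp [homMatrix]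

@[simp] theorem homMatrix_last (i : Fin (d + 1)) : Δ.homMatrix i (Fin.last d) = 1 := by
  simp [homMatrix]

@[simp] theorem realMatrix_castSucc (i : Fin (d + 1)) (j : Fin d) :
    Δ.realMatrix i j.castSucc = Δ.vertex i j := by simp [realMatrix]

@[simp] theorem realMatrix_last (i : Fin (d + 1)) : Δ.realMatrix i (Fin.last d) = 1 := by
  simp [realMatrix]

theorem vecMul_realMatrix (a : Fin (d + 1) → ℝ) :
    a ᵥ* Δ.realMatrix = homVec (∑ i, a i • intVec (Δ.vertex i)) (∑ i, a i) :=
  homVec_ext (by simp [vecMul, dotProduct, intVec]) (by simp [vecMul, dotProduct])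

theorem realMatrix_det_ne_zero : Δ.realMatrix.det ≠ 0 := by
  intro h
  obtain ⟨a, ha, h0⟩ := Matrix.exists_vecMul_eq_zero_iff.mpr h
  rw [vecMul_realMatrix] at h0
  have h1 : ∑ i, a i = 0 := by simpa using congrFun h0 (Fin.last d)
  have h2 : ∑ i, a i • intVec (Δ.vertex i) = 0 := by
    funext j
    simpa using congrFun h0 j.castSucc
  exact ha (funext fun i => (affineIndependent_iff.mp Δ.affineIndependent) Finset.univ a h1 h2 i
    (Finset.mem_univ i))

theorem isUnit_realMatrix_det : IsUnit Δ.realMatrix.det := Δ.realMatrix_det_ne_zero.isUnit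

/-- The barycentric coordinates of `x` with respect to `Δ`, scaled to have sum `k`. -/
noncomputable def bary (k : ℝ) (x : Fin d → ℝ) : Fin (d + 1) → ℝ := homVec x k ᵥ* Δ.realMatrix⁻¹

theorem bary_vecMul (k : ℝ) (x : Fin d → ℝ) : Δ.bary k x ᵥ* Δ.realMatrix = homVec x k := by
  rw [bary, vecMul_vecMul, nonsing_inv_mul _ Δ.isUnit_realMatrix_det, vecMul_one]

theorem eq_bary {k : ℝ} {x : Fin d → ℝ} {c : Fin (d + 1) → ℝ}
    (h : c ᵥ* Δ.realMatrix = homVec x k) : c = Δ.bary k x := by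
  rw [bary, ← h, vecMul_vecMul, mul_nonsing_inv _ Δ.isUnit_realMatrix_det, vecMul_one]

theorem sum_bary (k : ℝ) (x : Fin d → ℝ) : ∑ i, Δ.bary k x i = k := by
  simpa [vecMul_realMatrix] using congrFun (Δ.bary_vecMul k x) (Fin.last d)

theorem sum_bary_smul (k : ℝ) (x : Fin d → ℝ) :
    ∑ i, Δ.bary k x i • intVec (Δ.vertex i) = x := by
  funext j
  simpa [vecMul_realMatrix] using congrFun (Δ.bary_vecMul k x) j.castSucc

theorem bary_sum (a : Fin (d + 1) → ℝ) :
    Δ.bary (∑ i, a i) (∑ i, a i • intVec (Δ.vertex i)) = a :=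
  (Δ.eq_bary (Δ.vecMul_realMatrix a)).symm

theorem bary_combination (a b k l : ℝ) (x y : Fin d → ℝ) :
    Δ.bary (a * k + b * l) (a • x + b • y) = a • Δ.bary k x + b • Δ.bary l y := by
  rw [bary, homVec_combination, add_vecMul, smul_vecMul, smul_vecMul, bary, bary]

theorem bary_vertex (i : Fin (d + 1)) : Δ.bary 1 (intVec (Δ.vertex i)) = Pi.single i 1 := by
  have h := Δ.bary_sum (Pi.single i 1)
  simpa [Pi.single_apply] using h

theorem bary_smul (a k : ℝ) (x : Fin d → ℝ) : Δ.bary (a * k) (a • x) = a • Δ.bary k x := by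
  simpa using Δ.bary_combination a 0 k 0 x 0

theorem continuous_bary (k : ℝ) : Continuous (Δ.bary k) := by
  unfold bary
  have h : Continuous fun x : Fin d → ℝ => homVec x k := by
    refine continuous_pi fun i => ?_
    induction i using Fin.lastCases with
    | last => simpa using continuous_const
    | cast i => simpa using continuous_apply i
  exact h.matrix_vecMul continuous_const

theorem mem_polytope {x : Fin d → ℝ} : x ∈ Δ.polytope ↔ ∀ i, 0 ≤ Δ.bary 1 x i := by
  constructor
  · intro hx
    have hsub : Δ.polytope ⊆ {x | ∀ i, 0 ≤ Δ.bary 1 x i} := by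
      refine convexHull_min ?_ ?_
      · rintro _ ⟨j, rfl⟩ i
        rw [bary_vertex, Pi.single_apply]
        split_ifs <;> norm_num
      · intro x hx y hy a b ha hb hab i
        have h := Δ.bary_combination a b 1 1 x y
        rw [mul_one, mul_one, hab] at h
        rw [h]
        exact add_nonneg (mul_nonneg ha (hx i)) (mul_nonneg hb (hy i))
    exact hsub hx
  · intro h
    exact mem_convexHull_of_exists_fintype (Δ.bary 1 x) (fun i => intVec (Δ.vertex i)) h
      (Δ.sum_bary 1 x) (fun i => ⟨i, rfl⟩) (Δ.sum_bary_smul 1 x)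

theorem mem_smul_polytope {k : ℝ} (hk : 0 < k) {x : Fin d → ℝ} :
    x ∈ k • Δ.polytope ↔ ∀ i, 0 ≤ Δ.bary k x i := by
  have h := Δ.bary_smul k⁻¹ k x
  rw [inv_mul_cancel₀ hk.ne'] at h
  rw [Set.mem_smul_set_iff_inv_smul_mem₀ hk.ne', mem_polytope, h]
  refine forall_congr' fun i => ?_
  simp [hk]

/-- If a coordinate vanished at an interior point, a small step away from the corresponding vertex
would make it negative. Conversely, positivity of all coordinates is an open condition. -/
theorem mem_interior_smul_polytope {k : ℝ} (hk : 0 < k) {x : Fin d → ℝ} :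
    x ∈ interior (k • Δ.polytope) ↔ ∀ i, 0 < Δ.bary k x i := by
  constructor
  · intro hx i
    have hxm := (Δ.mem_smul_polytope hk).mp (interior_subset hx)
    refine lt_of_le_of_ne (hxm i) fun h0 => ?_
    have hc : Continuous fun t : ℝ => x + t • (x - k • intVec (Δ.vertex i)) := by fun_prop
    have hmem : ∀ᶠ t in nhds (0 : ℝ), x + t • (x - k • intVec (Δ.vertex i)) ∈ k • Δ.polytope := by
      refine hc.continuousAt.eventually_mem ?_
      simpa using mem_interior_iff_mem_nhds.mp hx
    obtain ⟨ε, hε, hball⟩ := Metric.eventually_nhds_iff.mp hmem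
    have hm := (Δ.mem_smul_polytope hk).mp
      (hball (y := ε / 2) (by rw [Real.dist_0_eq_abs, abs_of_pos (by linarith)]; linarith)) i
    have e : x + (ε / 2) • (x - k • intVec (Δ.vertex i)) =
        (1 + ε / 2) • x + (-(ε / 2) * k) • intVec (Δ.vertex i) := by module
    have h := Δ.bary_combination (1 + ε / 2) (-(ε / 2) * k) k 1 x (intVec (Δ.vertex i))
    rw [show (1 + ε / 2) * k + -(ε / 2) * k * 1 = k by ring, ← e, bary_vertex] at h
    rw [h] at hm
    simp only [Pi.add_apply, Pi.smul_apply, ← h0, Pi.single_eq_same, smul_eq_mul] at hm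
    nlinarith [mul_pos hε hk]
  · intro h
    refine mem_interior.mpr ⟨{y | ∀ i, 0 < Δ.bary k y i}, fun y hy =>
      (Δ.mem_smul_polytope hk).mpr fun i => (hy i).le, ?_, h⟩
    rw [Set.ofPred_forall]
    exact isOpen_iInter_of_finite fun i =>
      isOpen_lt continuous_const ((continuous_apply i).comp (Δ.continuous_bary k))

end LatticeSimplex

/-! ### Half-integral simplices are Gorenstein of degree 3 and not pyramids -/

theorem intVec_injective {d : ℕ} : Function.Injective (intVec (d := d)) := fun a b h =>
  funext fun i => by simpa [intVec] using congrFun h i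

theorem mem_pyramid {d : ℕ} {Q : Set (Fin d → ℝ)} (hQ : Convex ℝ Q) (hne : Q.Nonempty)
    {x : Fin (d + 1) → ℝ} (hx : x ∈ pyramid Q) :
    ∃ a b : ℝ, 0 ≤ a ∧ 0 ≤ b ∧ a + b = 1 ∧
      ∃ q ∈ Q, x = homVec (b • q) a := by
  have himg : ((fun x : Fin d → ℝ => (Fin.snoc x 0 : Fin (d + 1) → ℝ)) '' Q) =
      (homVec · 0) '' Q := rfl
  have hlin : IsLinearMap ℝ fun x : Fin d → ℝ => homVec x (0 : ℝ) := by
    constructor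
    · intro x y
      exact homVec_ext (by simp) (by simp)
    · intro c x
      exact homVec_ext (by simp) (by simp)
  have hconv : Convex ℝ ((homVec · (0 : ℝ)) '' Q) := hQ.is_linear_image hlin
  rw [pyramid, Set.union_singleton, convexHull_insert (hne.image _), himg, hconv.convexHull_eq] at hx
  simp only [mem_convexJoin, Set.mem_singleton_iff, exists_eq_left] at hx
  obtain ⟨_, ⟨q, hq, rfl⟩, a, b, ha, hb, hab, rfl⟩ := hx
  refine ⟨a, b, ha, hb, hab, q, hq, ?_⟩
  refine homVec_ext (fun i => ?_) ?_ <;> simp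

namespace LatticeSimplex

theorem vertex_injective {d : ℕ} (Δ : LatticeSimplex d) : Function.Injective Δ.vertex :=
  fun i j h => Δ.affineIndependent.injective (by simp [h])

theorem vertex_mem_polytope {d : ℕ} (Δ : LatticeSimplex d) (i : Fin (d + 1)) :
    intVec (Δ.vertex i) ∈ Δ.polytope := subset_convexHull ℝ _ ⟨i, rfl⟩

/-- A simplex whose barycenter of weights `1/2` is a lattice point of the appropriate height is not
a lattice pyramid. -/
theorem not_isLatticePyramid_of_sum_even {d : ℕ} (Δ : LatticeSimplex (d + 1))
    {z : Fin (d + 2) → ℤ} (hz : ∀ k, ∑ i, Δ.homMatrix i k = 2 * z k) :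
    ¬ IsLatticePyramid Δ.polytope := by
  rintro ⟨Q, ⟨W, hW, rfl⟩, U, w, hU, hP⟩
  have hmul : U * U⁻¹ = 1 := mul_nonsing_inv U hU
  set Q := convexHull ℝ (intVec '' (W : Set (Fin d → ℤ))) with hQ
  have hne : Q.Nonempty := by
    rw [hQ, convexHull_nonempty_iff]
    exact (Finset.coe_nonempty.mpr hW).image _
  set A : (Fin (d + 1) → ℝ) → Fin (d + 1) → ℝ :=
    fun x => vecMul x (U.map (Int.cast : ℤ → ℝ)) + intVec w with hA
  -- The vertices in coordinates where the polytope is literally `pyramid Q`.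
  let t : Fin (d + 2) → Fin (d + 1) → ℤ := fun i => vecMul (Δ.vertex i - w) U⁻¹
  have hinv : ∀ y x, A y = x → y = vecMul (x - intVec w) (U⁻¹.map (Int.cast : ℤ → ℝ)) := by
    rintro y x rfl
    simp only [hA, add_sub_cancel_right]
    rw [vecMul_vecMul, ← map_cast_mul, hmul]
    simp
  have hsub : ∀ a b : Fin (d + 1) → ℤ, intVec (a - b) = intVec a - intVec b := by
    intro a b; ext i; simp [intVec]
  have ht : ∀ i, intVec (t i) ∈ pyramid Q := by
    intro i
    have h := Δ.vertex_mem_polytope i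
    rw [hP] at h
    obtain ⟨y, hy, hyi⟩ := h
    have h := hinv y _ hyi
    rw [← hsub, intVec_vecMul] at h
    rwa [← h]
  have htinj : Function.Injective t := by
    intro i j hij
    have h := congrArg (fun s => vecMul s U) hij
    simp only [t, vecMul_vecMul, nonsing_inv_mul U hU, vecMul_one] at h
    exact Δ.vertex_injective (by simpa using h)
  -- On the pyramid the last coordinate lies in `[0, 1]` and equals `1` only at the apex.
  have hval : ∀ i, t i (Fin.last d) = 0 ∨
      (t i (Fin.last d) = 1 ∧ intVec (t i) = homVec (0 : Fin d → ℝ) 1) := by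
    intro i
    obtain ⟨a, b, ha, hb, hab, q, -, he⟩ := mem_pyramid (convex_convexHull ℝ _) hne (ht i)
    have hl : (t i (Fin.last d) : ℝ) = a := by simpa [intVec] using congrFun he (Fin.last d)
    have h0 : 0 ≤ t i (Fin.last d) := by exact_mod_cast hl ▸ ha
    have h1 : t i (Fin.last d) ≤ 1 := by
      have : (t i (Fin.last d) : ℝ) ≤ 1 := by rw [hl]; linarith
      exact_mod_cast this
    obtain h | h : t i (Fin.last d) = 0 ∨ t i (Fin.last d) = 1 := by omega
    · exact Or.inl h
    · refine Or.inr ⟨h, ?_⟩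
      rw [h, Int.cast_one] at hl
      obtain rfl : b = 0 := by linarith
      rw [he, ← hl, zero_smul]
  -- The apex is an affine combination of the vertices, so they cannot all have last coordinate `0`.
  have hex : ∃ j, t j (Fin.last d) = 1 := by
    by_contra hno
    have hall : ∀ j, t j (Fin.last d) = 0 := fun j =>
      (hval j).resolve_right fun h => hno ⟨j, h.1⟩
    have hapex : A (homVec 0 1) ∈ Δ.polytope := by
      rw [hP]
      exact ⟨_, subset_convexHull ℝ _ (Or.inr rfl), rfl⟩
    have hx := hinv _ _ rfl |>.symm.trans (rfl : homVec (0 : Fin d → ℝ) 1 = _)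
    set x := A (homVec 0 1)
    have hs := Δ.sum_bary_smul 1 x
    have hs' : x - intVec w = ∑ i, Δ.bary 1 x i • intVec (Δ.vertex i - w) := by
      simp only [hsub, smul_sub, Finset.sum_sub_distrib, hs, ← Finset.sum_smul, Δ.sum_bary, one_smul]
    rw [hs', sum_vecMul] at hx
    have h := congrFun hx (Fin.last d)
    simp only [smul_vecMul, intVec_vecMul, homVec_last, Finset.sum_apply, Pi.smul_apply] at h
    rw [Finset.sum_eq_zero] at h
    · norm_num at h
    · intro i _
      have : intVec ((Δ.vertex i - w) ᵥ* U⁻¹) (Fin.last d) = 0 := by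
        have := hall i
        simp only [t] at this
        simp [intVec, this]
      rw [this, smul_zero]
  obtain ⟨j, hj⟩ := hex
  have hone : ∑ i, t i (Fin.last d) = 1 := by
    rw [Finset.sum_eq_single j, hj]
    · intro i _ hij
      refine (hval i).resolve_right fun h => hij (htinj (intVec_injective ?_))
      rw [h.2, ((hval j).resolve_left (by omega)).2]
    · simp
  -- The number of vertices is even, so the translation by `w`, subtracted once per vertex, keeps
  -- the vertex sum in `2ℤ^(d+1)`. This contradicts `hone`.
  have hlast : ((d : ℤ) + 2) = 2 * z (Fin.last _) := by
    have h := hz (Fin.last _)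
    simp only [homMatrix_last, Finset.sum_const, Finset.card_univ, Fintype.card_fin] at h
    simp only [nsmul_eq_mul, Nat.cast_add, Nat.cast_one, mul_one] at h
    omega
  have hsum : ∑ i, t i = (2 : ℤ) • vecMul ((fun k => z k.castSucc) - z (Fin.last _) • w) U⁻¹ := by
    simp only [t]
    rw [← sum_vecMul, ← smul_vecMul]
    congr 1
    ext k
    have h := hz k.castSucc
    simp only [homMatrix_castSucc] at h
    simp [Finset.sum_sub_distrib, h]
    rw [hlast]
    ring
  have h := congrFun hsum (Fin.last d)
  rw [Finset.sum_apply, hone, Pi.smul_apply, smul_eq_mul] at h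
  omega

/-- Twice every barycentric coordinate of a lattice point is an integer, and the point with all
coordinates `1/2` is a lattice point. -/
def IsHalfIntegral {d : ℕ} (Δ : LatticeSimplex d) : Prop :=
  (∃ B : Matrix (Fin (d + 1)) (Fin (d + 1)) ℤ, Δ.homMatrix * B = (2 : ℤ) • 1) ∧
    ∃ z : Fin (d + 1) → ℤ, ∀ k, ∑ i, Δ.homMatrix i k = 2 * z k

/-- `B` is twice the inverse of the homogeneous matrix, so doubled barycentric coordinates are
integral linear forms in `(x, k)`. -/
theorem two_smul_bary {d : ℕ} (Δ : LatticeSimplex d) {B : Matrix (Fin (d + 1)) (Fin (d + 1)) ℤ}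
    (hB : Δ.homMatrix * B = (2 : ℤ) • 1) (k : ℝ) (x : Fin d → ℝ) :
    (2 : ℝ) • Δ.bary k x = homVec x k ᵥ* B.map (Int.cast : ℤ → ℝ) := by
  rw [← Δ.bary_vecMul k x, vecMul_vecMul, realMatrix, ← map_cast_mul, hB]
  have : ((2 : ℤ) • (1 : Matrix (Fin (d + 1)) (Fin (d + 1)) ℤ)).map (Int.cast : ℤ → ℝ) =
      (2 : ℝ) • 1 := by
    ext i j
    rw [map_apply, Matrix.smul_apply, Matrix.smul_apply, one_apply, one_apply]
    split_ifs <;> simp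
  rw [this, vecMul_smul, vecMul_one]

theorem two_mul_bary_int {d : ℕ} (Δ : LatticeSimplex d)
    {B : Matrix (Fin (d + 1)) (Fin (d + 1)) ℤ} (hB : Δ.homMatrix * B = (2 : ℤ) • 1) (k : ℤ)
    (z : Fin d → ℤ) (i : Fin (d + 1)) :
    2 * Δ.bary k (intVec z) i = ((homVec z k ᵥ* B) i : ℤ) := by
  have h := congrFun (Δ.two_smul_bary hB k (intVec z)) i
  rw [homVec_intVec, intVec_vecMul] at h
  simpa [intVec] using h

theorem bary_center (Δ : LatticeSimplex 5) {z : Fin 6 → ℤ}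
    (hz : ∀ k, ∑ i, Δ.homMatrix i k = 2 * z k) :
    Δ.bary 3 (intVec fun k => z k.castSucc) = fun _ => 1 / 2 := by
  symm
  apply Δ.eq_bary
  rw [vecMul_realMatrix]
  refine homVec_ext (d := 5) (fun k => ?_) ?_
  · have h := hz k.castSucc
    simp only [homMatrix_castSucc] at h
    have h' : ∑ i, (Δ.vertex i k : ℝ) = 2 * z k.castSucc := by exact_mod_cast h
    simp only [homVec_castSucc, Finset.sum_apply, Pi.smul_apply, intVec, smul_eq_mul,
      ← Finset.mul_sum, h']
    ring
  · rw [homVec_last, homVec_last]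
    simp
    norm_num

/-- Half the sum of the vertices is an interior lattice point of `3Δ`. Conversely, the six
coordinates of an interior lattice point of `nΔ` are positive half-integers with sum `n`, whence `n
≥ 3`. -/
theorem codegree_of_isHalfIntegral {Δ : LatticeSimplex 5} (h : Δ.IsHalfIntegral) :
    codegree Δ.polytope = 3 := by
  obtain ⟨⟨B, hB⟩, z, hz⟩ := h
  refine IsLeast.csInf_eq ⟨⟨by norm_num, intVec fun k => z k.castSucc, ?_, ⟨_, rfl⟩⟩, ?_⟩
  · rw [mem_interior_smul_polytope _ (by norm_num)]
    intro i
    rw [Nat.cast_ofNat, Δ.bary_center hz]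
    norm_num
  · rintro n ⟨hn, _, hx, y, rfl⟩
    have hx := (Δ.mem_interior_smul_polytope (by exact_mod_cast hn)).mp hx
    have hs := Δ.sum_bary n (intVec y)
    have hge : ∀ i, (1 : ℝ) / 2 ≤ Δ.bary n (intVec y) i := by
      intro i
      have h2 := Δ.two_mul_bary_int hB n y i
      have hp := hx i
      rw [Int.cast_natCast] at h2
      have : (0 : ℝ) < ((homVec y (n : ℤ) ᵥ* B) i : ℤ) := by rw [← h2]; linarith
      have h1 : (1 : ℝ) ≤ ((homVec y (n : ℤ) ᵥ* B) i : ℤ) := by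
        have h1 : 0 < (homVec y (n : ℤ) ᵥ* B) i := by exact_mod_cast this
        exact_mod_cast h1
      linarith
    have h3 := Finset.sum_le_sum fun i (_ : i ∈ Finset.univ) => hge i
    rw [hs] at h3
    norm_num at h3
    exact_mod_cast h3

theorem eq_zero_of_forall_vertex {d : ℕ} (Δ : LatticeSimplex d) {a : Fin d → ℝ} {c : ℝ}
    (h : ∀ i, intVec (Δ.vertex i) ⬝ᵥ a + c = 0) : a = 0 := by
  have h0 : Δ.realMatrix *ᵥ homVec a c = 0 := by
    funext i
    rw [mulVec, dotProduct, Fin.sum_univ_castSucc]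
    simpa [dotProduct, intVec] using h i
  have h1 := eq_zero_of_mulVec_eq_zero Δ.realMatrix_det_ne_zero h0
  funext i
  simpa using congrFun h1 i.castSucc

/-- With `u` half the sum of the vertices, `3Δ - u` is reflexive. Its dual is the simplex on the
points `y i`, the negated columns of `B` without their last entry, because `⟨x - u, y i⟩ = 1 - 2
β_i(x)`. -/
theorem isGorenstein_of_isHalfIntegral {Δ : LatticeSimplex 5} (h : Δ.IsHalfIntegral) :
    IsGorenstein Δ.polytope := by
  obtain ⟨⟨B, hB⟩, z, hz⟩ := h
  set u : Fin 5 → ℤ := fun k => z k.castSucc with hu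
  set Q : Set (Fin 5 → ℝ) := (fun x => x + intVec (-u)) '' ((3 : ℝ) • Δ.polytope) with hQ
  have hneg : intVec (-u) = -intVec u := by ext i; simp [intVec]
  let q : Fin 6 → Fin 5 → ℤ := fun i => (3 : ℤ) • Δ.vertex i - u
  have hq : ∀ i, intVec (q i) = (3 : ℝ) • intVec (Δ.vertex i) - intVec u := by
    intro i; ext k; simp [q, intVec]
  let y : Fin 6 → Fin 5 → ℤ := fun i k => -B k.castSucc i
  have hpair : ∀ x i, (x - intVec u) ⬝ᵥ intVec (y i) = 1 - 2 * Δ.bary 3 x i := by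
    intro x i
    have h1 := congrFun (Δ.two_smul_bary hB 3 x) i
    have h2 := congrFun (Δ.two_smul_bary hB 3 (intVec u)) i
    rw [Δ.bary_center hz] at h2
    simp only [vecMul, dotProduct, Fin.sum_univ_castSucc (n := 5), homVec_castSucc, homVec_last,
      Pi.smul_apply, smul_eq_mul, map_apply] at h1 h2
    have h3 : (x - intVec u) ⬝ᵥ intVec (y i) =
        ∑ k, intVec u k * (B k.castSucc i : ℝ) - ∑ k, x k * (B k.castSucc i : ℝ) := by
      simp only [dotProduct, y, intVec, Pi.sub_apply, ← Finset.sum_sub_distrib]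
      refine Finset.sum_congr rfl fun k _ => ?_
      push_cast
      ring
    linarith
  have hQmem : ∀ i, intVec (q i) ∈ Q := fun i =>
    ⟨(3 : ℝ) • intVec (Δ.vertex i), Set.smul_mem_smul_set (Δ.vertex_mem_polytope i), by
      rw [hq, hneg, sub_eq_add_neg]⟩
  have hsumq : ∑ i, intVec (q i) = 0 := by
    have := Δ.sum_bary_smul 3 (intVec u)
    rw [Δ.bary_center hz, ← Finset.smul_sum] at this
    simp only [hq, Finset.sum_sub_distrib, ← Finset.smul_sum]
    simp only [Finset.sum_const, Finset.card_univ, Fintype.card_fin]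
    rw [← this]
    module
  refine ⟨3, by norm_num, Q, ⟨?_, ?_, ?_⟩, 1, -u, by simp, by simp [hQ]⟩
  · refine ⟨Finset.univ.image q, by simp, ?_⟩
    have hf : (fun x : Fin 5 → ℝ => x + intVec (-u)) '' ((3 : ℝ) • Δ.polytope) =
        ((AffineMap.homothety (0 : Fin 5 → ℝ) (3 : ℝ)) +
          AffineMap.const ℝ (Fin 5 → ℝ) (intVec (-u))) '' Δ.polytope := by
      rw [← Set.image_smul, Set.image_image]
      exact Set.image_congr fun x _ => by simp [AffineMap.homothety_apply]
    rw [hQ, hf, polytope, AffineMap.image_convexHull, ← Set.range_comp, Finset.coe_image,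
      Finset.coe_univ, Set.image_univ, ← Set.range_comp]
    congr 2
    funext i
    simp [AffineMap.homothety_apply, hq, hneg, sub_eq_add_neg]
  · have h1 : intVec u ∈ interior ((3 : ℝ) • Δ.polytope) := by
      rw [mem_interior_smul_polytope _ (by norm_num)]
      intro i
      rw [Δ.bary_center hz]
      norm_num
    have h2 := (Homeomorph.addRight (intVec (-u))).image_interior ((3 : ℝ) • Δ.polytope)
    have h3 : (0 : Fin 5 → ℝ) ∈ Homeomorph.addRight (intVec (-u)) ''
        interior ((3 : ℝ) • Δ.polytope) := ⟨_, h1, by simp [hneg]⟩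
    rw [h2] at h3
    exact h3
  · refine ⟨Finset.univ.image y, by simp, Set.Subset.antisymm ?_ (convexHull_min ?_ ?_)⟩
    · intro p hp
      have hle : ∀ i, intVec (q i) ⬝ᵥ p ≤ 1 := fun i => hp _ (hQmem i)
      -- From this table and the vanishing of the sum of the `q i`, a dual point `p` has barycentric
      -- coordinates `(1 - ⟨q i, p⟩) / 6` with respect to the `y i`; the dual inequalities make them
      -- nonnegative.
      have hqy : ∀ i j, intVec (q j) ⬝ᵥ intVec (y i) = 1 - 6 * (Pi.single j 1 : Fin 6 → ℝ) i := by
        intro i j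
        have h := Δ.bary_smul 3 1 (intVec (Δ.vertex j))
        rw [mul_one, bary_vertex] at h
        rw [hq, hpair, h, Pi.smul_apply, smul_eq_mul]
        ring
      have hsum : ∑ i, (1 - intVec (q i) ⬝ᵥ p) / 6 = 1 := by
        rw [← Finset.sum_div, Finset.sum_sub_distrib, ← sum_dotProduct, hsumq]
        simp
      refine mem_convexHull_of_exists_fintype (fun i => (1 - intVec (q i) ⬝ᵥ p) / 6)
        (fun i => intVec (y i)) (fun i => by have := hle i; linarith) hsum
        (fun i => ⟨y i, by simp, rfl⟩) ?_
      rw [← sub_eq_zero]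
      set e := ∑ i, ((1 - intVec (q i) ⬝ᵥ p) / 6) • intVec (y i) with he
      have hz0 : ∀ j, intVec (q j) ⬝ᵥ (e - p) = 0 := by
        intro j
        rw [dotProduct_sub, he, dotProduct_sum]
        simp only [dotProduct_smul, hqy, smul_eq_mul, mul_sub, Finset.sum_sub_distrib, mul_one, hsum]
        simp [Pi.single_apply]
      refine Δ.eq_zero_of_forall_vertex (c := -(intVec u ⬝ᵥ (e - p)) / 3) fun j => ?_
      have := hz0 j
      rw [hq, sub_dotProduct, smul_dotProduct, smul_eq_mul] at this
      linarith
    · rintro _ ⟨_, hyi, rfl⟩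
      simp only [Finset.coe_image, Finset.coe_univ, Set.image_univ, Set.mem_range] at hyi
      obtain ⟨i, rfl⟩ := hyi
      rintro _ ⟨x, hx, rfl⟩
      have := (Δ.mem_smul_polytope (by norm_num)).mp hx i
      simp only [hneg, ← sub_eq_add_neg]
      rw [hpair]
      linarith
    · intro a ha b hb s t hs ht hst x hx
      have h1 := ha x hx
      have h2 := hb x hx
      rw [dotProduct_add, dotProduct_smul, dotProduct_smul, smul_eq_mul, smul_eq_mul]
      nlinarith

theorem isNonpyramidal_of_isHalfIntegral {Δ : LatticeSimplex 5} (h : Δ.IsHalfIntegral) :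
    Δ.IsNonpyramidalGorensteinDegreeThree :=
  ⟨isGorenstein_of_isHalfIntegral h,
    by rw [polytopeDegree, codegree_of_isHalfIntegral h]; norm_num,
    h.2.elim fun _ hz => Δ.not_isLatticePyramid_of_sum_even hz⟩

end LatticeSimplex

/-! ### Reflexivity and non-pyramidality force half-integrality -/

theorem intVec_dotProduct {d : ℕ} (a b : Fin d → ℤ) :
    intVec a ⬝ᵥ intVec b = ((a ⬝ᵥ b : ℤ) : ℝ) := by
  simp [intVec, dotProduct]

theorem mulVec_intVec {d : ℕ} (M : Matrix (Fin d) (Fin d) ℤ) (b : Fin d → ℤ) :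
    M.map (Int.cast : ℤ → ℝ) *ᵥ intVec b = intVec (M *ᵥ b) := by
  ext i
  simp [intVec, mulVec, dotProduct]

theorem intVec_add {d : ℕ} (a b : Fin d → ℤ) : intVec (a + b) = intVec a + intVec b := by
  ext i; simp [intVec]

theorem homVec_dotProduct {R : Type*} [CommRing R] {d : ℕ} (x y : Fin d → R) (k l : R) :
    homVec x k ⬝ᵥ homVec y l = x ⬝ᵥ y + k * l := by
  simp [dotProduct, Fin.sum_univ_castSucc]

theorem image_convexHull_vecMul_add {m n : ℕ} (M : Matrix (Fin m) (Fin n) ℝ) (w : Fin n → ℝ)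
    (s : Set (Fin m → ℝ)) :
    (fun x => x ᵥ* M + w) '' convexHull ℝ s = convexHull ℝ ((fun x => x ᵥ* M + w) '' s) := by
  have h : (fun x : Fin m → ℝ => x ᵥ* M + w) =
      ⇑(M.vecMulLinear.toAffineMap + AffineMap.const ℝ (Fin m → ℝ) w) := by
    ext x; simp
  rw [h, AffineMap.image_convexHull]

namespace LatticeSimplex

/-- A simplex with a facet at lattice distance one from the opposite vertex is a lattice
pyramid. -/
theorem isLatticePyramid_of_mulVec_eq_single {d : ℕ} (Δ : LatticeSimplex (d + 1))
    {b : Fin (d + 2) → ℤ} {i : Fin (d + 2)} (hb : Δ.homMatrix *ᵥ b = Pi.single i 1) :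
    IsLatticePyramid Δ.polytope := by
  obtain ⟨j₀, hj₀⟩ := exists_ne i
  let ℓ : (Fin (d + 1) → ℤ) →ₗ[ℤ] ℤ :=
    { toFun := fun x => x ⬝ᵥ fun k => b k.castSucc
      map_add' := fun x y => add_dotProduct x y _
      map_smul' := fun c x => smul_dotProduct c x _ }
  have hℓ : ∀ j, ℓ (Δ.vertex j) + b (Fin.last _) = (Pi.single i 1 : Fin (d + 2) → ℤ) j := by
    intro j
    rw [← hb, mulVec, dotProduct, Fin.sum_univ_castSucc]
    simp [ℓ, dotProduct]
  set t := Δ.vertex i - Δ.vertex j₀ with htdef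
  have h0 := hℓ j₀
  rw [Pi.single_eq_of_ne hj₀] at h0
  have ht : ℓ t = 1 := by
    have h1 := hℓ i
    rw [Pi.single_eq_same] at h1
    rw [htdef, map_sub]
    omega
  -- Since `ℓ t = 1`, the lattice is `ker ℓ ⊕ ℤt`. In a basis adapted to this splitting, with origin
  -- `v_{j₀}`, the facet opposite `v_i` has last coordinate `0` and `v_i` becomes the apex.
  obtain ⟨n, bk⟩ := Submodule.basisOfPid (Pi.basisFun ℤ (Fin (d + 1))) (LinearMap.ker ℓ)
  let bs := Module.Basis.mkFinSnoc bk t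
    (fun c x hx h => by
      have := congrArg ℓ h
      rw [LinearMap.mem_ker] at hx
      simpa [ht, hx, -zsmul_eq_mul] using this)
    (fun z => ⟨-ℓ z, by simp [LinearMap.mem_ker, ht, -zsmul_eq_mul]⟩)
  have hbs : (bs : Fin (n + 1) → Fin (d + 1) → ℤ) = Fin.snoc ((↑) ∘ bk) t :=
    Module.Basis.coe_mkFinSnoc _ _ _ _
  obtain rfl : d = n := by
    have h1 := Module.finrank_eq_card_basis bs
    simp only [Module.finrank_fintype_fun_eq_card, Fintype.card_fin] at h1
    omega
  let U : Matrix (Fin (d + 1)) (Fin (d + 1)) ℤ := of bs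
  have hU : IsUnit U.det := by
    have h := (Pi.basisFun ℤ (Fin (d + 1))).isUnit_det bs
    rwa [Pi.basisFun_det_apply] at h
  have hrow : ∀ (a : Fin d → ℤ) (c : ℤ), homVec a c ᵥ* U = ∑ k, a k • (bk k : Fin (d + 1) → ℤ) +
      c • t := by
    intro a c
    have h1 : ∀ k : Fin d, U k.castSucc = bk k := fun k => by
      change bs k.castSucc = _
      rw [hbs]
      simp
    have h2 : U (Fin.last d) = t := by
      change bs (Fin.last d) = _
      rw [hbs]
      simp
    rw [vecMul_eq_sum, Fin.sum_univ_castSucc]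
    simp only [h1, h2, homVec_castSucc, homVec_last]
  -- The value at `j = i` is arbitrary; only the facet vertices have coordinates in `ker ℓ`.
  have hcoord : ∀ j, ∃ a : Fin d → ℤ, j ≠ i → homVec a 0 ᵥ* U = Δ.vertex j - Δ.vertex j₀ := by
    intro j
    by_cases hj : j = i
    · exact ⟨0, fun h => absurd hj h⟩
    · have hk : Δ.vertex j - Δ.vertex j₀ ∈ LinearMap.ker ℓ := by
        have h1 := hℓ j
        rw [Pi.single_eq_of_ne hj] at h1
        rw [LinearMap.mem_ker, map_sub]
        omega
      refine ⟨bk.repr ⟨_, hk⟩, fun _ => ?_⟩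
      have h := congrArg Subtype.val (bk.sum_repr ⟨_, hk⟩)
      rw [hrow, zero_smul, add_zero]
      simpa only [Submodule.coe_sum, Submodule.coe_smul] using h
  choose a ha using hcoord
  refine ⟨convexHull ℝ (intVec '' ((Finset.univ.erase i).image a : Set (Fin d → ℤ))),
    ⟨(Finset.univ.erase i).image a, ?_, by simp⟩, U, Δ.vertex j₀, hU, ?_⟩
  · exact Finset.Nonempty.image ⟨j₀, by simp [hj₀]⟩ a
  · have hlin : IsLinearMap ℝ fun x : Fin d → ℝ => (Fin.snoc x 0 : Fin (d + 1) → ℝ) :=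
      ⟨fun x y => homVec_ext (by simp) (by simp), fun c x => homVec_ext (by simp) (by simp)⟩
    rw [pyramid, hlin.image_convexHull, convexHull_convexHull_union_left,
      image_convexHull_vecMul_add, polytope]
    congr 1
    have hval : ∀ (a : Fin d → ℤ) (c : ℤ), (Fin.snoc (intVec a) (c : ℝ) : Fin (d + 1) → ℝ) ᵥ*
        U.map (Int.cast : ℤ → ℝ) + intVec (Δ.vertex j₀) =
          intVec (homVec a c ᵥ* U + Δ.vertex j₀) := by
      intro a c
      change homVec (intVec a) (c : ℝ) ᵥ* _ + _ = _
      rw [homVec_intVec, intVec_vecMul, intVec_add]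
    have hapex : (Fin.snoc (0 : Fin d → ℝ) 1 : Fin (d + 1) → ℝ) ᵥ*
        U.map (Int.cast : ℤ → ℝ) + intVec (Δ.vertex j₀) = intVec (Δ.vertex i) := by
      have h := hval 0 1
      rw [hrow] at h
      have hz : intVec (0 : Fin d → ℤ) = 0 := by ext; simp [intVec]
      simpa [htdef, hz] using h
    ext x
    constructor
    · rintro ⟨j, rfl⟩
      by_cases hj : j = i
      · subst hj
        exact ⟨_, Or.inr rfl, hapex⟩
      · refine ⟨_, Or.inl ⟨intVec (a j), ⟨a j, ?_, rfl⟩, rfl⟩, ?_⟩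
        · simp only [Finset.coe_image, Set.mem_image]
          exact ⟨j, by simp [hj], rfl⟩
        · have h := hval (a j) 0
          rw [ha j hj] at h
          simpa using h
    · rintro ⟨_, ⟨_, ⟨z, hz, rfl⟩, rfl⟩ | rfl, rfl⟩
      · simp only [Finset.coe_image, Set.mem_image] at hz
        obtain ⟨j, hj, rfl⟩ := hz
        have hj : j ≠ i := by simpa using hj
        refine ⟨j, ?_⟩
        have h := hval (a j) 0
        rw [ha j hj] at h
        simpa using h.symm
      · exact ⟨i, hapex.symm⟩

theorem bary_zero_apply {d : ℕ} (Δ : LatticeSimplex d) (x : Fin d → ℝ) (i : Fin (d + 1)) :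
    Δ.bary 0 x i = x ⬝ᵥ fun l => Δ.realMatrix⁻¹ l.castSucc i := by
  simp [bary, vecMul, dotProduct, Fin.sum_univ_castSucc]

/-- If `rΔ` is reflexive with respect to its interior lattice point `p`, then every facet of `Δ` is
cut out by an integral affine functional with value `1` at `p`. -/
theorem exists_facet_functional {d : ℕ} (Δ : LatticeSimplex (d + 1)) {r : ℕ} (hr : 0 < r)
    {U : Matrix (Fin (d + 1)) (Fin (d + 1)) ℤ} {w : Fin (d + 1) → ℤ} (hU : IsUnit U.det)
    (hdual : IsLatticePolytope (dualPolytope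
      ((fun x => vecMul x (U.map (Int.cast : ℤ → ℝ)) + intVec w) '' ((r : ℝ) • Δ.polytope))))
    {p : Fin (d + 1) → ℤ} (hp : p ᵥ* U + w = 0) (hpos : ∀ i, 0 < Δ.bary r (intVec p) i)
    (i : Fin (d + 2)) :
    ∃ (b : Fin (d + 2) → ℤ) (m : ℤ), Δ.homMatrix *ᵥ b = Pi.single i m ∧
      (m : ℝ) * Δ.bary r (intVec p) i = 1 := by
  have hr' : (0 : ℝ) < r := by exact_mod_cast hr
  set A : (Fin (d + 1) → ℝ) → Fin (d + 1) → ℝ :=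
    fun x => vecMul x (U.map (Int.cast : ℤ → ℝ)) + intVec w with hA
  set β := Δ.bary r (intVec p) with hβ
  set c : Fin (d + 1) → ℝ := fun l => Δ.realMatrix⁻¹ l.castSucc i with hc
  have hmul : U * U⁻¹ = 1 := mul_nonsing_inv U hU
  have hmulR : U.map (Int.cast : ℤ → ℝ) * (U⁻¹).map (Int.cast : ℤ → ℝ) = 1 := by
    rw [← map_cast_mul, hmul]; simp
  have hAp : ∀ x, A x = (x - intVec p) ᵥ* U.map (Int.cast : ℤ → ℝ) := by
    intro x
    have h : intVec p ᵥ* U.map (Int.cast : ℤ → ℝ) + intVec w = 0 := by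
      rw [intVec_vecMul, ← intVec_add, hp]; ext; simp [intVec]
    simp only [hA]
    rw [sub_vecMul, eq_neg_of_add_eq_zero_left h, sub_neg_eq_add]
  -- The normal of facet `i`, scaled so that the pairing with it is `1` on that facet.
  set y : Fin (d + 1) → ℝ := -(1 / β i) • ((U⁻¹).map (Int.cast : ℤ → ℝ) *ᵥ c) with hy
  have hpair : ∀ x, A x ⬝ᵥ y = 1 - Δ.bary r x i / β i := by
    intro x
    have h := Δ.bary_combination 1 (-1) r r x (intVec p)
    rw [show (1 : ℝ) * r + -1 * r = 0 by ring, one_smul, neg_one_smul, ← sub_eq_add_neg] at h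
    have h := congrFun h i
    rw [bary_zero_apply, ← hc] at h
    rw [hAp, hy, dotProduct_smul, dotProduct_mulVec, vecMul_vecMul, hmulR, vecMul_one, h]
    have := (hpos i).ne'
    simp only [Pi.add_apply, Pi.smul_apply, smul_eq_mul, ← hβ]
    field_simp
    ring
  have hydual : y ∈ dualPolytope (A '' ((r : ℝ) • Δ.polytope)) := by
    rintro _ ⟨x, hx, rfl⟩
    rw [hpair]
    have := div_nonneg ((Δ.mem_smul_polytope hr').mp hx i) (hpos i).le
    linarith
  let q : Fin (d + 2) → Fin (d + 1) → ℤ := fun j => ((r : ℤ) • Δ.vertex j) ᵥ* U + w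
  have hq : ∀ j, intVec (q j) = A ((r : ℝ) • intVec (Δ.vertex j)) := by
    intro j
    simp only [q, hA]
    rw [intVec_add, ← intVec_vecMul]
    congr 2
    ext k
    simp [intVec]
  have hqy : ∀ j, j ≠ i → intVec (q j) ⬝ᵥ y = 1 := by
    intro j hj
    have h := Δ.bary_smul r 1 (intVec (Δ.vertex j))
    rw [mul_one, bary_vertex] at h
    rw [hq, hpair, h, Pi.smul_apply, Pi.single_eq_of_ne hj.symm]
    simp
  obtain ⟨W, -, hW⟩ := hdual
  have hlin : IsLinearMap ℝ fun z : Fin (d + 1) → ℝ =>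
      (∑ j ∈ Finset.univ.erase i, intVec (q j)) ⬝ᵥ z :=
    ⟨fun x y => dotProduct_add _ _ _, fun a x => dotProduct_smul a _ _⟩
  -- It is not necessary to know that `y` is a vertex of the dual. Some lattice generator `ω` of the
  -- dual does at least as well as `y` for the sum of the pairings with `q j`, `j ≠ i`. Each of
  -- these is at most `1`, the value at `y`, so all are equal to `1` at `ω`.
  have hconv := (IsLinearMap.mk' _ hlin).convexOn (convex_univ (𝕜 := ℝ))
  obtain ⟨_, ⟨ω, hω, rfl⟩, hge⟩ := hconv.exists_ge_of_mem_convexHull (Set.subset_univ _)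
    (hW ▸ hydual)
  have hωdual : intVec ω ∈ dualPolytope (A '' ((r : ℝ) • Δ.polytope)) := by
    rw [hW]
    exact subset_convexHull ℝ _ ⟨ω, hω, rfl⟩
  have hle : ∀ j, intVec (q j) ⬝ᵥ intVec ω ≤ 1 := fun j => hωdual _
    ⟨_, Set.smul_mem_smul_set (Δ.vertex_mem_polytope j), (hq j).symm⟩
  simp only [IsLinearMap.mk'_apply, sum_dotProduct] at hge
  have heq : ∀ j ∈ Finset.univ.erase i, intVec (q j) ⬝ᵥ y = intVec (q j) ⬝ᵥ intVec ω := by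
    have hle' : ∀ j ∈ Finset.univ.erase i,
        intVec (q j) ⬝ᵥ intVec ω ≤ intVec (q j) ⬝ᵥ y := fun j hj => by
      rw [hqy j (Finset.ne_of_mem_erase hj)]; exact hle j
    have := (Finset.sum_eq_sum_iff_of_le hle').mp (le_antisymm (Finset.sum_le_sum hle') hge)
    exact fun j hj => (this j hj).symm
  have hone : ∀ j, j ≠ i → q j ⬝ᵥ ω = 1 := by
    intro j hj
    have h := heq j (by simp [hj])
    rw [hqy j hj, intVec_dotProduct] at h
    exact_mod_cast h.symm
  obtain ⟨j₀, hj₀⟩ := exists_ne i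
  have hval : ∀ j, (Δ.homMatrix *ᵥ homVec (-(U *ᵥ ω)) (Δ.vertex j₀ ⬝ᵥ (U *ᵥ ω))) j =
      Δ.vertex j₀ ⬝ᵥ (U *ᵥ ω) - Δ.vertex j ⬝ᵥ (U *ᵥ ω) := by
    intro j
    change homVec (Δ.vertex j) 1 ⬝ᵥ _ = _
    rw [homVec_dotProduct, dotProduct_neg]
    ring
  have hqω : ∀ j, q j ⬝ᵥ ω = r * (Δ.vertex j ⬝ᵥ (U *ᵥ ω)) + w ⬝ᵥ ω := by
    intro j
    simp only [q]
    rw [add_dotProduct, ← dotProduct_mulVec, smul_dotProduct, smul_eq_mul]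
  -- The affine functional `x ↦ ⟨v_{j₀} - x, Uω⟩`, extended homogeneously. It vanishes on facet `i`,
  -- and reflexivity gives it the value `1` at `(p, r)`.
  set b := homVec (-(U *ᵥ ω)) (Δ.vertex j₀ ⬝ᵥ (U *ᵥ ω)) with hb
  have hsingle : Δ.homMatrix *ᵥ b = Pi.single i ((Δ.homMatrix *ᵥ b) i) := by
    funext j
    by_cases hj : j = i
    · subst hj; simp
    · rw [Pi.single_eq_of_ne hj, hval]
      have h1 := hone j hj
      rw [← hone j₀ hj₀, hqω, hqω] at h1
      have h2 : (r : ℤ) ≠ 0 := by exact_mod_cast hr.ne'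
      have h3 := mul_left_cancel₀ h2 (add_right_cancel h1)
      omega
  refine ⟨b, (Δ.homMatrix *ᵥ b) i, hsingle, ?_⟩
  have h1 : (β ᵥ* Δ.realMatrix) ⬝ᵥ intVec b = ((homVec p (r : ℤ) ⬝ᵥ b : ℤ) : ℝ) := by
    rw [hβ, bary_vecMul, ← intVec_dotProduct, ← homVec_intVec p, Int.cast_natCast]
  have h2 : homVec p (r : ℤ) ⬝ᵥ b = 1 := by
    rw [hb, homVec_dotProduct, dotProduct_neg, dotProduct_mulVec, eq_neg_of_add_eq_zero_left hp,
      ← hone j₀ hj₀, hqω, neg_dotProduct]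
    ring
  rw [← dotProduct_mulVec, realMatrix, mulVec_intVec, hsingle, h2] at h1
  rw [dotProduct, Finset.sum_eq_single i] at h1
  · simpa [intVec, mul_comm] using h1
  · intro j _ hj
    simp [intVec, hj]
  · simp

/-- Each barycentric coordinate of the reflexive centre is `1 / m i` with `m i ≥ 2`, since `m i = 1`
yields a pyramid. Six numbers at most `1/2` with sum `r ≥ 3` are all `1/2`. -/
theorem isHalfIntegral_of_isNonpyramidal {Δ : LatticeSimplex 5}
    (h : Δ.IsNonpyramidalGorensteinDegreeThree) : Δ.IsHalfIntegral := by
  obtain ⟨⟨r, hr, _, ⟨-, h0, hD⟩, U, w, hU, rfl⟩, hdeg, hpyr⟩ := h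
  have hr' : (0 : ℝ) < r := by exact_mod_cast hr
  have hmul : U⁻¹ * U = 1 := nonsing_inv_mul U hU
  have hmul' : U * U⁻¹ = 1 := mul_nonsing_inv U hU
  set p : Fin 5 → ℤ := -(w ᵥ* U⁻¹) with hpdef
  have hp : p ᵥ* U + w = 0 := by
    rw [hpdef, neg_vecMul, vecMul_vecMul, hmul, vecMul_one, neg_add_cancel]
  have hint : intVec p ∈ interior ((r : ℝ) • Δ.polytope) := by
    set A : (Fin 5 → ℝ) → Fin 5 → ℝ :=
      fun x => vecMul x (U.map (Int.cast : ℤ → ℝ)) + intVec w with hA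
    have hAc : Continuous A := by
      have : Continuous fun x : Fin 5 → ℝ => x ᵥ* U.map (Int.cast : ℤ → ℝ) :=
        continuous_id.matrix_vecMul continuous_const
      exact this.add continuous_const
    have hAi : Function.Injective A := by
      intro x y hxy
      have h := congrArg (fun z => z ᵥ* U⁻¹.map (Int.cast : ℤ → ℝ)) (add_right_cancel hxy)
      simp only [vecMul_vecMul, ← map_cast_mul, hmul'] at h
      simpa using h
    refine mem_interior.mpr ⟨A ⁻¹' interior (A '' ((r : ℝ) • Δ.polytope)), fun x hx => ?_,
      isOpen_interior.preimage hAc, ?_⟩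
    · obtain ⟨y, hy, hyx⟩ := interior_subset hx
      rwa [← hAi hyx]
    · have : A (intVec p) = 0 := by
        simp only [hA]
        rw [intVec_vecMul, ← intVec_add, hp]
        ext; simp [intVec]
      rwa [Set.mem_preimage, this]
  have hpos := (Δ.mem_interior_smul_polytope hr').mp hint
  have hr3 : 3 ≤ r := by
    have h1 : codegree Δ.polytope ≤ r := Nat.sInf_le ⟨hr, intVec p, hint, p, rfl⟩
    rw [polytopeDegree] at hdeg
    push_cast at hdeg
    omega
  choose b m hb hm using Δ.exists_facet_functional hr hU hD hp hpos
  have hm2 : ∀ i, (2 : ℝ) ≤ m i := by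
    intro i
    have h1 : (0 : ℝ) < m i := by
      by_contra hneg
      nlinarith [hm i, hpos i]
    have h2 : 0 < m i := by exact_mod_cast h1
    have h3 : m i ≠ 1 := fun h => hpyr (Δ.isLatticePyramid_of_mulVec_eq_single (h ▸ hb i))
    have h4 : 2 ≤ m i := by omega
    exact_mod_cast h4
  have hhalf : ∀ i, Δ.bary r (intVec p) i ≤ 1 / 2 := by
    intro i
    nlinarith [hm i, hpos i, hm2 i]
  have hsum := Δ.sum_bary r (intVec p)
  have hr3' : (3 : ℝ) ≤ r := by exact_mod_cast hr3
  have heq : ∀ i, Δ.bary r (intVec p) i = 1 / 2 := by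
    have hs : ∑ i : Fin 6, (1 / 2 : ℝ) ≤ ∑ i, Δ.bary r (intVec p) i := by
      rw [hsum]; norm_num; exact hr3
    have := (Finset.sum_eq_sum_iff_of_le fun i (_ : i ∈ Finset.univ) => hhalf i).mp
      (le_antisymm (Finset.sum_le_sum fun i _ => hhalf i) hs)
    exact fun i => this i (Finset.mem_univ i)
  have hmeq : ∀ i, m i = 2 := by
    intro i
    have h := hm i
    rw [heq i] at h
    have : (m i : ℝ) = 2 := by linarith
    exact_mod_cast this
  -- The columns of `B` are the facet functionals, each with value `2` at its own vertex, and `z` is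
  -- the centre `(p, r)`.
  refine ⟨⟨of fun k i => b i k, ?_⟩, homVec p r, fun k => ?_⟩
  · ext j i
    have h := congrFun (hb i) j
    rw [hmeq i] at h
    rw [Matrix.smul_apply, one_apply, mul_apply]
    rw [Pi.single_apply] at h
    simpa [mulVec, dotProduct] using h
  · have h := congrFun (Δ.bary_vecMul r (intVec p)) k
    have h2 := congrFun (homVec_intVec p (r : ℤ)) k
    rw [Int.cast_natCast] at h2
    rw [h2] at h
    simp only [vecMul, dotProduct, heq, realMatrix, map_apply, ← Finset.mul_sum] at h
    have h3 : (∑ i, (Δ.homMatrix i k : ℝ)) = 2 * (homVec p (r : ℤ) k : ℤ) := by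
      have : intVec (homVec p (r : ℤ)) k = (homVec p (r : ℤ) k : ℤ) := rfl
      linarith
    exact_mod_cast h3

end LatticeSimplex

/-! ### Unimodular equivalence and congruence of vertices modulo 2 -/

theorem mem_intLattice {d : ℕ} {x : Fin d → ℝ} : x ∈ intLattice d ↔ ∀ k, ∃ z : ℤ, x k = z := by
  constructor
  · rintro ⟨z, rfl⟩ k
    exact ⟨z k, rfl⟩
  · intro h
    choose z hz using h
    exact ⟨z, funext fun k => (hz k).symm⟩

/-- If the rows of `V` generate a lattice containing `2ℤ^n`, and every integral combination of them
that is divisible by `2` stays so for the rows of `V'`, then `V'` is an integral multiple of `V`. -/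
theorem exists_mul_eq_of_even {n : ℕ} {V V' B : Matrix (Fin n) (Fin n) ℤ} (hV : V.det ≠ 0)
    (hB : V * B = (2 : ℤ) • 1)
    (h : ∀ a : Fin n → ℤ, (∀ k, 2 ∣ (a ᵥ* V) k) → ∀ k, 2 ∣ (a ᵥ* V') k) :
    ∃ U, V * U = V' := by
  have hBV : B * V = (2 : ℤ) • 1 := by
    have h1 : V * (B * V - (2 : ℤ) • 1) = 0 := by
      rw [mul_sub, ← mul_assoc, hB, smul_mul_assoc, mul_smul_comm, one_mul, mul_one, sub_self]
    have h2 := congrArg (fun M => V.adjugate * M) h1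
    simp only [← mul_assoc, adjugate_mul, mul_zero] at h2
    rw [smul_mul_assoc, one_mul, smul_eq_zero] at h2
    exact sub_eq_zero.mp (h2.resolve_left hV)
  -- As `B * V = 2`, the hypothesis applies to each row of `B`. Then `U = B V' / 2` satisfies `V U =
  -- V'`.
  have hdiv : ∀ i k, 2 ∣ (B * V') i k := by
    intro i k
    refine h (B i) (fun k => ?_) k
    have h1 := congrFun (congrFun hBV i) k
    rw [mul_apply, Matrix.smul_apply] at h1
    exact ⟨_, h1⟩
  choose U hU using hdiv
  refine ⟨of U, ?_⟩
  have hU' : B * V' = (2 : ℤ) • of U := by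
    ext i k
    rw [hU]
    rfl
  have h1 : (2 : ℤ) • (V * of U) = (2 : ℤ) • V' := by
    rw [← mul_smul_comm, ← hU', ← mul_assoc, hB, smul_mul_assoc, one_mul]
  exact smul_right_injective _ (by norm_num : (2 : ℤ) ≠ 0) h1

namespace LatticeSimplex

theorem homMatrix_det_ne_zero {d : ℕ} (Δ : LatticeSimplex d) : Δ.homMatrix.det ≠ 0 := by
  intro h
  have h1 := RingHom.map_det (Int.castRingHom ℝ) Δ.homMatrix
  rw [h, map_zero] at h1
  exact Δ.realMatrix_det_ne_zero h1.symm

/-- Lattice simplices whose homogeneous matrices agree up to a unimodular factor and a permutation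
of the vertices are unimodularly equivalent. -/
theorem unimodularEquiv_of_mul_eq {d : ℕ} (Δ Δ' : LatticeSimplex d) (σ : Equiv.Perm (Fin (d + 1)))
    {U U' : Matrix (Fin (d + 1)) (Fin (d + 1)) ℤ}
    (hU : Δ.homMatrix * U = Δ'.homMatrix.submatrix σ id)
    (hU' : Δ'.homMatrix.submatrix σ id * U' = Δ.homMatrix) :
    UnimodularEquiv Δ.polytope Δ'.polytope := by
  have hcancel : ∀ a : Fin (d + 1) → ℤ, Δ.homMatrix *ᵥ a = 0 → a = 0 := fun a ha =>
    eq_zero_of_mulVec_eq_zero Δ.homMatrix_det_ne_zero ha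
  -- Both matrices have last column all ones, so the last column of `U` is the last unit vector;
  -- thus `U` encodes an affine map.
  have hlast : ∀ l : Fin d, U l.castSucc (Fin.last d) = 0 := by
    have h1 : (fun l => U l (Fin.last d)) - Pi.single (Fin.last d) 1 = 0 := by
      apply hcancel
      rw [mulVec_sub, mulVec_single_one]
      ext i
      have h := congrFun (congrFun hU i) (Fin.last d)
      rw [mul_apply] at h
      simpa [mulVec, dotProduct] using sub_eq_zero.mpr h
    intro l
    have h := congrFun h1 l.castSucc
    simpa using h
  have hUU : U * U' = 1 := by
    have h1 : Δ.homMatrix * (U * U' - 1) = 0 := by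
      rw [mul_sub, ← mul_assoc, hU, hU', mul_one, sub_self]
    have h2 := congrArg (fun M => Δ.homMatrix.adjugate * M) h1
    simp only [← mul_assoc, adjugate_mul, mul_zero] at h2
    rw [smul_mul_assoc, one_mul, smul_eq_zero] at h2
    exact sub_eq_zero.mp (h2.resolve_left Δ.homMatrix_det_ne_zero)
  have hdet : IsUnit (U.submatrix Fin.castSucc Fin.castSucc : Matrix (Fin d) (Fin d) ℤ).det := by
    refine isUnit_det_of_right_inverse (B := U'.submatrix Fin.castSucc Fin.castSucc) ?_
    ext i j
    have h := congrFun (congrFun hUU i.castSucc) j.castSucc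
    rw [mul_apply, Fin.sum_univ_castSucc, hlast, zero_mul, add_zero] at h
    rw [mul_apply]
    simpa [one_apply] using h
  refine ⟨_, fun k => U (Fin.last d) k.castSucc, hdet, ?_⟩
  rw [polytope, polytope, image_convexHull_vecMul_add, ← Set.range_comp,
    ← σ.surjective.range_comp]
  congr 2
  funext i
  have h : Δ'.vertex (σ i) = Δ.vertex i ᵥ* U.submatrix Fin.castSucc Fin.castSucc +
      fun k => U (Fin.last d) k.castSucc := by
    funext k
    have h := congrFun (congrFun hU i) k.castSucc
    rw [mul_apply, Fin.sum_univ_castSucc] at h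
    simpa [vecMul, dotProduct] using h.symm
  simp only [Function.comp_apply]
  rw [intVec_vecMul, ← intVec_add, h]

/-- A unimodular equivalence of lattice simplices maps vertices to vertices. -/
theorem exists_perm_of_unimodularEquiv {d : ℕ} {Δ Δ' : LatticeSimplex d}
    (h : UnimodularEquiv Δ.polytope Δ'.polytope) :
    ∃ (σ : Equiv.Perm (Fin (d + 1))) (U : Matrix (Fin d) (Fin d) ℤ) (w : Fin d → ℤ),
      IsUnit U.det ∧ ∀ i, Δ'.vertex (σ i) = Δ.vertex i ᵥ* U + w := by
  obtain ⟨U, w, hU, hP⟩ := h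
  set A : (Fin d → ℝ) → Fin d → ℝ :=
    fun x => vecMul x (U.map (Int.cast : ℤ → ℝ)) + intVec w with hA
  have hAv : ∀ i, A (intVec (Δ.vertex i)) = intVec (Δ.vertex i ᵥ* U + w) := by
    intro i
    simp only [hA]
    rw [intVec_vecMul, intVec_add]
  have hex : ∀ j, ∃ i, Δ'.vertex j = Δ.vertex i ᵥ* U + w := by
    intro j
    -- The `j`-th coordinate takes the value `1` on the image, hence at least `1` at the image of
    -- some vertex. There the other coordinates, being nonnegative, must vanish, so this image is
    -- `v'_j`.
    have hconv : ConvexOn ℝ Set.univ fun x => Δ'.bary 1 (A x) j := by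
      refine ⟨convex_univ, fun x _ y _ a b _ _ hab => le_of_eq ?_⟩
      have h := Δ'.bary_combination a b 1 1 (A x) (A y)
      rw [mul_one, mul_one, hab] at h
      have e : A (a • x + b • y) = a • A x + b • A y := by
        simp only [hA]
        rw [add_vecMul, smul_vecMul, smul_vecMul]
        nth_rewrite 1 [← one_smul ℝ (intVec w), ← hab]
        module
      simp only [e, h]
      simp
    have hj := Δ'.vertex_mem_polytope j
    rw [hP] at hj
    obtain ⟨y, hy, hyj⟩ := hj
    obtain ⟨_, ⟨i, rfl⟩, hge⟩ := hconv.exists_ge_of_mem_convexHull (Set.subset_univ _) hy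
    rw [hyj, bary_vertex, Pi.single_eq_same] at hge
    have hmem : A (intVec (Δ.vertex i)) ∈ Δ'.polytope := by
      rw [hP]
      exact ⟨_, Δ.vertex_mem_polytope i, rfl⟩
    have hnn := Δ'.mem_polytope.mp hmem
    have hs := Δ'.sum_bary 1 (A (intVec (Δ.vertex i)))
    rw [← Finset.add_sum_erase _ _ (Finset.mem_univ j)] at hs
    have h0 : ∑ k ∈ Finset.univ.erase j, Δ'.bary 1 (A (intVec (Δ.vertex i))) k = 0 :=
      le_antisymm (by linarith) (Finset.sum_nonneg fun k _ => hnn k)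
    have h0' := (Finset.sum_eq_zero_iff_of_nonneg fun k _ => hnn k).mp h0
    have hcomb := Δ'.sum_bary_smul 1 (A (intVec (Δ.vertex i)))
    rw [Finset.sum_eq_single j (fun k _ hk => by rw [h0' k (by simp [hk]), zero_smul])
      (by simp), show Δ'.bary 1 (A (intVec (Δ.vertex i))) j = 1 by linarith, one_smul, hAv] at hcomb
    exact ⟨i, intVec_injective hcomb⟩
  choose f hf using hex
  have hinj : Function.Injective f := fun a b hab => Δ'.vertex_injective (by rw [hf a, hf b, hab])
  refine ⟨(Equiv.ofBijective f (Finite.injective_iff_bijective.mp hinj)).symm, U, w, hU,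
    fun i => ?_⟩
  rw [hf]
  congr
  exact Equiv.ofBijective_apply_symm_apply f _ i

/-- The reduction modulo `2` of the vector `(v_i, 1)`. -/
def rowModTwo {d : ℕ} (Δ : LatticeSimplex d) (i : Fin (d + 1)) : Fin (d + 1) → ZMod 2 :=
  fun k => (Δ.homMatrix i k : ZMod 2)

theorem rowModTwo_last {d : ℕ} (Δ : LatticeSimplex d) (i : Fin (d + 1)) :
    Δ.rowModTwo i (Fin.last d) = 1 := by simp [rowModTwo]

theorem rowModTwo_eq_iff {d : ℕ} (Δ : LatticeSimplex d) {i j : Fin (d + 1)} :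
    Δ.rowModTwo i = Δ.rowModTwo j ↔ ∃ t : Fin d → ℤ, Δ.vertex i - Δ.vertex j = (2 : ℤ) • t := by
  constructor
  · intro h
    have hk : ∀ k : Fin d, ∃ t : ℤ, Δ.vertex i k - Δ.vertex j k = 2 * t := by
      intro k
      have h1 := congrFun h k.castSucc
      simp only [rowModTwo, homMatrix_castSucc] at h1
      have h2 := (ZMod.intCast_eq_intCast_iff_dvd_sub _ _ 2).mp h1.symm
      exact h2
    choose t ht using hk
    exact ⟨t, funext fun k => by simpa using ht k⟩
  · rintro ⟨t, ht⟩
    refine homVec_ext (fun k => ?_) (by rw [rowModTwo_last, rowModTwo_last])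
    simp only [rowModTwo, homMatrix_castSucc]
    exact ((ZMod.intCast_eq_intCast_iff_dvd_sub _ _ 2).mpr ⟨t k, congrFun ht k⟩).symm

theorem halfVec_eq {d : ℕ} {i j : Fin (d + 1)} (hij : i ≠ j) :
    (halfVec i j : Fin (d + 1) → ℝ) =
      (1 / 2 : ℝ) • ((Pi.single i 1 : Fin (d + 1) → ℝ) + Pi.single j 1) := by
  funext k
  by_cases hi : k = i
  · subst hi; simp [halfVec, hij]
  · by_cases hj : k = j
    · subst hj; simp [halfVec, hi]
    · simp [halfVec, hi, hj]

/-- Half of `(v_i, 1) + (v_j, 1)` is integral exactly when the two rows agree modulo 2. Hence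
adjacency, together with equality, is an equivalence relation. -/
theorem graph_adj_iff {d : ℕ} (Δ : LatticeSimplex d) {i j : Fin (d + 1)} :
    Δ.graph.Adj i j ↔ i ≠ j ∧ Δ.rowModTwo i = Δ.rowModTwo j := by
  refine and_congr_right fun hij => ?_
  have hsum : ∑ k, (halfVec i j : Fin (d + 1) → ℝ) k = 1 := by
    rw [halfVec_eq hij]
    simp [← Finset.mul_sum, Finset.sum_add_distrib]
    norm_num
  have hvec : ∀ k, (∑ l, (halfVec i j : Fin (d + 1) → ℝ) l •
      (Fin.snoc (intVec (Δ.vertex l)) 1 : Fin (d + 1) → ℝ)) k =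
        ((Δ.homMatrix i k : ℝ) + Δ.homMatrix j k) / 2 := by
    intro k
    have h1 : ∀ l, (Fin.snoc (intVec (Δ.vertex l)) 1 : Fin (d + 1) → ℝ) k = Δ.homMatrix l k := by
      intro l
      change homVec (intVec (Δ.vertex l)) 1 k = _
      rw [← Int.cast_one, homVec_intVec]
      rfl
    rw [halfVec_eq hij, Finset.sum_apply]
    simp only [Pi.smul_apply, h1, smul_eq_mul, Pi.add_apply, mul_assoc, ← Finset.mul_sum, add_mul,
      Finset.sum_add_distrib]
    simp [Pi.single_apply]
    ring
  have hIco : ∀ k, (halfVec i j : Fin (d + 1) → ℝ) k ∈ Set.Ico (0 : ℝ) 1 := by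
    intro k
    simp only [halfVec]
    split_ifs <;> norm_num
  simp only [heightLayer, assocGroup, Set.mem_ofPred_eq, mem_intLattice, hvec, hsum, Nat.cast_one,
    and_true]
  rw [and_iff_right hIco, funext_iff]
  refine forall_congr' fun k => ?_
  simp only [rowModTwo]
  rw [ZMod.intCast_eq_intCast_iff_dvd_sub]
  constructor
  · rintro ⟨z, hz⟩
    have : Δ.homMatrix i k + Δ.homMatrix j k = 2 * z := by
      have : ((Δ.homMatrix i k : ℝ) + Δ.homMatrix j k) = 2 * z := by linarith
      exact_mod_cast this
    push_cast
    omega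
  · intro h
    obtain ⟨z, hz⟩ : (2 : ℤ) ∣ Δ.homMatrix i k + Δ.homMatrix j k := by
      push_cast at h
      omega
    refine ⟨z, ?_⟩
    rw [← Int.cast_add, hz]
    push_cast
    ring

/-- The equivalence permutes vertices and, being invertible over the integers, preserves
divisibility of their differences by 2. -/
theorem nonempty_graph_iso_of_unimodularEquiv {d : ℕ} {Δ Δ' : LatticeSimplex d}
    (h : UnimodularEquiv Δ.polytope Δ'.polytope) : Nonempty (Δ.graph ≃g Δ'.graph) := by
  obtain ⟨σ, U, w, hU, hσ⟩ := exists_perm_of_unimodularEquiv h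
  refine ⟨⟨σ, fun {i j} => ?_⟩⟩
  rw [graph_adj_iff, graph_adj_iff, σ.injective.ne_iff]
  refine and_congr_right fun _ => ?_
  rw [rowModTwo_eq_iff, rowModTwo_eq_iff, hσ, hσ, add_sub_add_right_eq_sub, ← sub_vecMul]
  constructor
  · rintro ⟨t, ht⟩
    refine ⟨t ᵥ* U⁻¹, ?_⟩
    rw [← smul_vecMul, ← ht, vecMul_vecMul, mul_nonsing_inv U hU, vecMul_one]
  · rintro ⟨t, ht⟩
    exact ⟨t ᵥ* U, by rw [ht, smul_vecMul]⟩

end LatticeSimplex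

/-! ### The code of relations modulo 2 is determined by the graph -/

theorem sum_smul_eq_sum_filter {ι M : Type*} [Fintype ι] [AddCommGroup M] [Module (ZMod 2) M]
    (c : ι → ZMod 2) (f : ι → M) : ∑ i, c i • f i = ∑ i with c i ≠ 0, f i := by
  rw [Finset.sum_filter]
  refine Finset.sum_congr rfl fun i _ => ?_
  obtain h | h : c i = 0 ∨ c i = 1 := by
    generalize c i = x
    revert x
    decide
  · simp [h]
  · simp [h]

/-- An even linear code of length six containing the all-ones word is determined by its words of
weight two (phrased for the linear relations between two families of vectors over `ℤ/2`). -/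
theorem sum_smul_eq_zero_of_pairs {M N : Type*} [AddCommGroup M] [Module (ZMod 2) M]
    [AddCommGroup N] [Module (ZMod 2) N] {r : Fin 6 → M} {s : Fin 6 → N}
    (φ : M →ₗ[ZMod 2] ZMod 2) (hφ : ∀ i, φ (r i) = 1) (hr : ∑ i, r i = 0) (hs : ∑ i, s i = 0)
    (hrs : ∀ i j, r i = r j → s i = s j) {c : Fin 6 → ZMod 2} (hc : ∑ i, c i • r i = 0) :
    ∑ i, c i • s i = 0 := by
  have hneg : ∀ a b : M, a + b = 0 → a = b := fun a b h => by
    rw [eq_neg_of_add_eq_zero_left h, ZModModule.neg_eq_self]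
  have hpair : ∀ S : Finset (Fin 6), S.card = 2 → ∑ i ∈ S, r i = 0 → ∑ i ∈ S, s i = 0 := by
    intro S hS h
    obtain ⟨i, j, hij, rfl⟩ := Finset.card_eq_two.mp hS
    rw [Finset.sum_pair hij] at h ⊢
    rw [hrs i j (hneg _ _ h), ZModModule.add_self]
  rw [sum_smul_eq_sum_filter] at hc ⊢
  set S : Finset (Fin 6) := Finset.univ.filter fun i => c i ≠ 0 with hS
  -- Applying `φ` to the relation counts its terms modulo 2.
  have heven : (S.card : ZMod 2) = 0 := by
    have h := congrArg φ hc
    simpa [hφ] using h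
  rw [ZMod.natCast_eq_zero_iff] at heven
  have hle : S.card ≤ 6 := by simpa using S.card_le_univ
  have hcompl : Sᶜ.card = 6 - S.card := by simp [Finset.card_compl]
  obtain h | h | h | h : S.card = 0 ∨ S.card = 2 ∨ S.card = 4 ∨ S.card = 6 := by omega
  · rw [Finset.card_eq_zero.mp h, Finset.sum_empty]
  · exact hpair S h hc
  -- Weight four: the all-ones relation makes the complementary pair a relation as well.
  · have h1 := hpair Sᶜ (by omega) (by
      have := Finset.sum_add_sum_compl S r
      rwa [hc, hr, zero_add] at this)
    have := Finset.sum_add_sum_compl S s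
    rwa [h1, hs, add_zero] at this
  · rw [(Finset.card_eq_iff_eq_univ S).mp (by simpa using h), hs]

namespace LatticeSimplex

theorem sum_rowModTwo {d : ℕ} {Δ : LatticeSimplex d} (h : Δ.IsHalfIntegral) :
    ∑ i, Δ.rowModTwo i = 0 := by
  obtain ⟨-, z, hz⟩ := h
  funext k
  have h1 := congrArg (Int.cast : ℤ → ZMod 2) (hz k)
  push_cast at h1
  rw [Finset.sum_apply]
  simp only [rowModTwo, h1, Pi.zero_apply]
  rw [show (2 : ZMod 2) = 0 from rfl, zero_mul]

theorem forall_dvd_vecMul_iff {d : ℕ} (Δ : LatticeSimplex d) (a : Fin (d + 1) → ℤ)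
    (σ : Equiv.Perm (Fin (d + 1))) :
    (∀ k, 2 ∣ (a ᵥ* Δ.homMatrix.submatrix σ id) k) ↔
      ∑ i, (a i : ZMod 2) • Δ.rowModTwo (σ i) = 0 := by
  rw [funext_iff]
  refine forall_congr' fun k => ?_
  have h := ZMod.intCast_zmod_eq_zero_iff_dvd ((a ᵥ* Δ.homMatrix.submatrix σ id) k) 2
  push_cast at h
  rw [← h]
  simp [vecMul, dotProduct, rowModTwo]

/-- The isomorphism matches pairs of congruent rows, hence all relations modulo 2, in both
directions. So each homogeneous matrix, after permuting rows, is an integral right multiple of the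
other. -/
theorem unimodularEquiv_of_graph_iso {Δ Δ' : LatticeSimplex 5} (h : Δ.IsHalfIntegral)
    (h' : Δ'.IsHalfIntegral) (e : Δ.graph ≃g Δ'.graph) :
    UnimodularEquiv Δ.polytope Δ'.polytope := by
  set σ : Equiv.Perm (Fin 6) := e.toEquiv with hσ
  have hrow : ∀ i j, Δ.rowModTwo i = Δ.rowModTwo j ↔
      Δ'.rowModTwo (σ i) = Δ'.rowModTwo (σ j) := by
    intro i j
    by_cases hij : i = j
    · subst hij; simp
    · have h1 := e.map_adj_iff (v := i) (w := j)
      rw [graph_adj_iff, graph_adj_iff] at h1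
      have h2 : e i ≠ e j := e.injective.ne hij
      simp only [ne_eq, hij, h2, not_false_eq_true, true_and] at h1
      exact h1.symm
  obtain ⟨B, hB⟩ := h.1
  obtain ⟨B', hB'⟩ := h'.1
  have hsum := sum_rowModTwo h
  have hsum' : ∑ i, Δ'.rowModTwo (σ i) = 0 := by
    rw [Equiv.sum_comp σ Δ'.rowModTwo, sum_rowModTwo h']
  have hdet' : (Δ'.homMatrix.submatrix σ id).det ≠ 0 := by
    rw [det_permute]
    refine mul_ne_zero ?_ Δ'.homMatrix_det_ne_zero
    exact_mod_cast (Equiv.Perm.sign σ).ne_zero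
  have hB'' : Δ'.homMatrix.submatrix σ id * B'.submatrix id σ = (2 : ℤ) • 1 := by
    rw [← submatrix_mul _ _ σ id σ Function.bijective_id, hB', submatrix_smul]
    simp
  have hid := Δ.forall_dvd_vecMul_iff (σ := 1)
  simp only [Equiv.Perm.coe_one, submatrix_id_id, id_eq] at hid
  let φ : (Fin 6 → ZMod 2) →ₗ[ZMod 2] ZMod 2 := LinearMap.proj (Fin.last 5)
  obtain ⟨U, hU⟩ := exists_mul_eq_of_even (V' := Δ'.homMatrix.submatrix σ id)
    Δ.homMatrix_det_ne_zero hB (fun a ha => by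
      rw [hid] at ha
      rw [forall_dvd_vecMul_iff]
      exact sum_smul_eq_zero_of_pairs φ (fun i => Δ.rowModTwo_last i) hsum hsum'
        (fun i j => (hrow i j).mp) ha)
  obtain ⟨U', hU'⟩ := exists_mul_eq_of_even (V' := Δ.homMatrix) hdet' hB'' (fun a ha => by
      rw [forall_dvd_vecMul_iff] at ha
      rw [hid]
      exact sum_smul_eq_zero_of_pairs φ (fun i => Δ'.rowModTwo_last (σ i)) hsum' hsum
        (fun i j => (hrow i j).mpr) ha)
  exact Δ.unimodularEquiv_of_mul_eq Δ' σ hU hU'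

end LatticeSimplex

/-! ### The six simplices and the possible graphs -/

namespace LatticeSimplex

/-- Twice the inverses of the homogeneous matrices of the six simplices. -/
def tableDualMatrix : Fin 6 → Fin 6 → Fin 6 → ℤ :=
  ![![![-2,2,0,0,0,0], ![-2,0,2,0,0,0], ![-2,0,0,2,0,0], ![-2,0,0,0,2,0], ![3,-1,-1,-1,-1,1], ![2,0,0,0,0,0]],
    ![![-2,2,0,0,0,0], ![-2,0,2,0,0,0], ![-2,0,0,2,0,0], ![-1,0,0,0,1,0], ![2,-1,-1,-1,0,1], ![2,0,0,0,0,0]],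
    ![![-2,2,0,0,0,0], ![-2,0,2,0,0,0], ![-1,0,0,1,0,0], ![-1,0,0,0,1,0], ![1,-1,-1,0,0,1], ![2,0,0,0,0,0]],
    ![![-2,2,0,0,0,0], ![-2,0,2,0,0,0], ![-1,0,0,1,0,0], ![0,0,-1,0,1,0], ![0,-1,0,0,0,1], ![2,0,0,0,0,0]],
    ![![-2,2,0,0,0,0], ![-1,0,1,0,0,0], ![-1,0,0,1,0,0], ![-1,0,0,0,1,0], ![0,-1,0,0,0,1], ![2,0,0,0,0,0]],
    ![![-1,1,0,0,0,0], ![-1,0,1,0,0,0], ![-1,0,0,1,0,0], ![-1,0,0,0,1,0], ![-1,0,0,0,0,1], ![2,0,0,0,0,0]]]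

theorem isHalfIntegral_tableSimplex (t : Fin 6) : (tableSimplex t).IsHalfIntegral := by
  have h1 : ∀ t i j, ((tableSimplex t).homMatrix * of (tableDualMatrix t)) i j =
      if i = j then 2 else 0 := by decide +kernel
  have h2 : ∀ t k, (2 : ℤ) ∣ ∑ i, (tableSimplex t).homMatrix i k := by decide +kernel
  refine ⟨⟨of (tableDualMatrix t), ?_⟩, ?_⟩
  · ext i j
    rw [h1, Matrix.smul_apply, one_apply]
    split_ifs <;> simp
  · choose z hz using h2 t
    exact ⟨z, hz⟩

/-- The block labels of the six graphs. -/
def tableBlocks : Fin 6 → Fin 6 → ℕ :=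
  ![![0,1,2,3,4,5], ![0,0,1,2,3,4], ![0,0,0,1,2,3], ![0,0,1,1,2,2], ![0,0,0,0,1,1],
    ![0,0,0,0,0,0]]

theorem tableGraph_adj (t i j : Fin 6) :
    (tableGraph t).Adj i j ↔ i ≠ j ∧ tableBlocks t i = tableBlocks t j := by
  fin_cases t <;> rfl

/-- The graph of a simplex is a given graph of the list as soon as a bijection of the indices matches
the classes of congruent vertices with the blocks. -/
theorem nonempty_graph_iso_tableGraph {Δ : LatticeSimplex 5} {t : Fin 6} {σ : Fin 6 → Fin 6}
    (hσ : Function.Injective σ)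
    (h : ∀ i j, Δ.rowModTwo i = Δ.rowModTwo j ↔ tableBlocks t (σ i) = tableBlocks t (σ j)) :
    Nonempty (Δ.graph ≃g tableGraph t) := by
  refine ⟨⟨Equiv.ofBijective σ (Finite.injective_iff_bijective.mp hσ), fun {i j} => ?_⟩⟩
  rw [graph_adj_iff, tableGraph_adj, h]
  simp only [Equiv.ofBijective_apply]
  rw [hσ.ne_iff]

theorem nonempty_tableSimplex_graph_iso (t : Fin 6) :
    Nonempty ((tableSimplex t).graph ≃g tableGraph t) := by
  -- Relabellings that send the classes of congruent vertices to the blocks of the listed graphs.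
  let σ : Fin 6 → Fin 6 → Fin 6 :=
    ![![0,1,2,3,4,5], ![0,2,3,4,1,5], ![0,3,4,1,2,5], ![0,4,2,1,3,5], ![0,4,1,2,3,5],
      ![0,1,2,3,4,5]]
  have h1 : ∀ t, Function.Injective (σ t) := by decide +kernel
  have h2 : ∀ t i j, (tableSimplex t).rowModTwo i = (tableSimplex t).rowModTwo j ↔
      tableBlocks t (σ t i) = tableBlocks t (σ t j) := by decide +kernel
  exact nonempty_graph_iso_tableGraph (h1 t) (h2 t)

instance (t : Fin 6) : DecidableRel (tableGraph t).Adj := fun i j =>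
  decidable_of_iff _ (tableGraph_adj t i j).symm

/-- The sum of squared degrees, counted as triples with two neighbours of a common vertex, separates
the six graphs. The number of edges would not: `K₃` and `3K₂` both have three. -/
theorem eq_of_tableGraph_iso {s t : Fin 6} (e : tableGraph s ≃g tableGraph t) : s = t := by
  let P : (t : Fin 6) → Fin 6 × Fin 6 × Fin 6 → Prop :=
    fun t p => (tableGraph t).Adj p.1 p.2.1 ∧ (tableGraph t).Adj p.1 p.2.2
  let E : Fin 6 × Fin 6 × Fin 6 ≃ Fin 6 × Fin 6 × Fin 6 :=
    e.toEquiv.prodCongr (e.toEquiv.prodCongr e.toEquiv)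
  have hE : ∀ p, P s p ↔ P t (E p) := fun p =>
    and_congr e.map_adj_iff.symm e.map_adj_iff.symm
  have hcard : Fintype.card {p : Fin 6 × Fin 6 × Fin 6 //
      (tableGraph s).Adj p.1 p.2.1 ∧ (tableGraph s).Adj p.1 p.2.2} =
      Fintype.card {p : Fin 6 × Fin 6 × Fin 6 //
        (tableGraph t).Adj p.1 p.2.1 ∧ (tableGraph t).Adj p.1 p.2.2} :=
    Fintype.card_congr (E.subtypeEquiv hE)
  have hval : ∀ t, Fintype.card {p : Fin 6 × Fin 6 × Fin 6 //
      (tableGraph t).Adj p.1 p.2.1 ∧ (tableGraph t).Adj p.1 p.2.2} =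
        (![0, 2, 12, 6, 38, 150] : Fin 6 → ℕ) t := by
    decide +kernel
  rw [hval, hval] at hcard
  have hinj : Function.Injective (![0, 2, 12, 6, 38, 150] : Fin 6 → ℕ) := by decide
  exact hinj hcard

/-- The position of `i` when the indices are sorted by decreasing size of the fibre of `f`, then by
the value of `f`. -/
def fibreRank (f : Fin 6 → Fin 6) (i : Fin 6) : Fin 6 :=
  -- A lexicographic key, as `f j < 6`. The count below omits `i` itself, so it is less than `6` and
  -- `Fin.ofNat` does not wrap around.
  let key : Fin 6 → ℕ := fun j => (6 - (Finset.univ.filter fun l => f l = f j).card) * 6 + f j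
  Fin.ofNat 6 (Finset.univ.filter fun j => key j < key i ∨ (key j = key i ∧ j < i)).card

/-- All indices outside of `i, j, k, l` are equivalent. -/
def RestRelated (f : Fin 6 → Fin 6) (i j k l : Fin 6) : Prop :=
  ∀ m, m ∉ [i, j, k, l] → ∀ n, n ∉ [i, j, k, l] → f m = f n

instance (f : Fin 6 → Fin 6) (i j k l : Fin 6) : Decidable (RestRelated f i j k l) := by
  unfold RestRelated; infer_instance

/-- Two disjoint pairs of equivalent indices force the remaining pair to be equivalent. -/
def PairsClosed (f : Fin 6 → Fin 6) : Prop :=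
  ∀ i j, i < j → f i = f j → ∀ k l, k < l → f k = f l → k ∉ [i, j] → l ∉ [i, j] →
    RestRelated f i j k l

instance (f : Fin 6 → Fin 6) : Decidable (PairsClosed f) := by
  unfold PairsClosed; infer_instance

/-- Up to a permutation of the indices, the fibres of `f` are the blocks of a graph of the list. -/
def HasTableBlocks (f : Fin 6 → Fin 6) : Prop :=
  ∃ t, Function.Injective (fibreRank f) ∧
    ∀ i j, f i = f j ↔ tableBlocks t (fibreRank f i) = tableBlocks t (fibreRank f j)

instance (f : Fin 6 → Fin 6) : Decidable (HasTableBlocks f) := by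
  unfold HasTableBlocks; infer_instance

/-- A partition is encoded by sending each index to a representative no larger than itself. This
leaves at most 6! functions, and `fibreRank` supplies the permutation explicitly, so evaluation
settles all cases. -/
theorem hasTableBlocks_of_pairsClosed (f : Fin 6 → Fin 6) (hf : ∀ i, f i ≤ i)
    (hid : ∀ i, f (f i) = f i) (hpairs : PairsClosed f) : HasTableBlocks f := by
  have key : ∀ a : Fin 6, a ≤ 1 → ∀ b : Fin 6, b ≤ 2 → ∀ c : Fin 6, c ≤ 3 → ∀ d : Fin 6, d ≤ 4 →
      ∀ e : Fin 6,
      (∀ i, ![0, a, b, c, d, e] (![0, a, b, c, d, e] i) = ![0, a, b, c, d, e] i) →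
      PairsClosed ![0, a, b, c, d, e] → HasTableBlocks ![0, a, b, c, d, e] := by
    decide +kernel
  have hfe : f = ![0, f 1, f 2, f 3, f 4, f 5] := by
    have h0 : f 0 = 0 := Fin.le_zero_iff.mp (hf 0)
    funext i
    fin_cases i <;> simp [h0]
  have h := key (f 1) (hf 1) (f 2) (hf 2) (f 3) (hf 3) (f 4) (hf 4) (f 5)
  rw [← hfe] at h
  exact h hid hpairs

/-- The six rows sum to zero modulo 2, so when two disjoint pairs of equal rows cancel, the
remaining two rows agree. This is the only constraint on the partition. -/
theorem exists_graph_iso_tableGraph {Δ : LatticeSimplex 5} (h : Δ.IsHalfIntegral) :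
    ∃ t, Nonempty (Δ.graph ≃g tableGraph t) := by
  have hsum := sum_rowModTwo h
  have hne : ∀ i, (Finset.univ.filter fun j => Δ.rowModTwo j = Δ.rowModTwo i).Nonempty :=
    fun i => ⟨i, by simp⟩
  let f : Fin 6 → Fin 6 := fun i => Finset.min' _ (hne i)
  have hfrow : ∀ i, Δ.rowModTwo (f i) = Δ.rowModTwo i := fun i =>
    (Finset.mem_filter.mp (Finset.min'_mem _ (hne i))).2
  have hf : ∀ i j, f i = f j ↔ Δ.rowModTwo i = Δ.rowModTwo j := by
    intro i j
    constructor
    · intro hij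
      rw [← hfrow i, hij, hfrow]
    · intro hij
      simp only [f, hij]
  have hpairs : PairsClosed f := by
    intro i j hij h1 k l hkl h2 hk hl m hm n hn
    by_cases hmn : m = n
    · rw [hmn]
    rw [hf] at h1 h2 ⊢
    simp only [List.mem_cons, List.not_mem_nil, or_false, not_or] at hk hl hm hn
    obtain ⟨hki, hkj⟩ := hk
    obtain ⟨hli, hlj⟩ := hl
    obtain ⟨hmi, hmj, hmk, hml⟩ := hm
    obtain ⟨hni, hnj, hnk, hnl⟩ := hn
    have e1 : i ∉ ({j, k, l, m, n} : Finset (Fin 6)) := by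
      simp [hij.ne, Ne.symm hki, Ne.symm hli, Ne.symm hmi, Ne.symm hni]
    have e2 : j ∉ ({k, l, m, n} : Finset (Fin 6)) := by
      simp [Ne.symm hkj, Ne.symm hlj, Ne.symm hmj, Ne.symm hnj]
    have e3 : k ∉ ({l, m, n} : Finset (Fin 6)) := by simp [hkl.ne, Ne.symm hmk, Ne.symm hnk]
    have e4 : l ∉ ({m, n} : Finset (Fin 6)) := by simp [Ne.symm hml, Ne.symm hnl]
    have huniv : (Finset.univ : Finset (Fin 6)) = {i, j, k, l, m, n} := by
      symm
      rw [← Finset.card_eq_iff_eq_univ, Fintype.card_fin, Finset.card_insert_of_notMem e1,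
        Finset.card_insert_of_notMem e2, Finset.card_insert_of_notMem e3,
        Finset.card_insert_of_notMem e4, Finset.card_pair hmn]
    rw [huniv, Finset.sum_insert e1, Finset.sum_insert e2, Finset.sum_insert e3,
      Finset.sum_insert e4, Finset.sum_pair hmn, h1, h2, ← add_assoc, ZModModule.add_self,
      zero_add, ← add_assoc, ZModModule.add_self, zero_add] at hsum
    rw [eq_neg_of_add_eq_zero_left hsum, ZModModule.neg_eq_self]
  obtain ⟨t, ht, hblocks⟩ := hasTableBlocks_of_pairsClosed f
    (fun i => Finset.min'_le _ _ (by simp)) (fun i => by rw [hf, hfrow]) hpairs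
  exact ⟨t, nonempty_graph_iso_tableGraph ht fun i j => by rw [← hf, hblocks]⟩

end LatticeSimplex

/-! ### Lattice points and the `h^*`-polynomial -/

theorem PowerSeries.coeff_mk_one_pow_card {ι : Type*} [Fintype ι] [DecidableEq ι] (n : ℕ) :
    PowerSeries.coeff n ((PowerSeries.mk 1 : PowerSeries ℤ) ^ Fintype.card ι) =
      ((Finset.piAntidiag (Finset.univ : Finset ι) n).card : ℤ) := by
  rw [← Finset.card_univ, ← Finset.prod_const, PowerSeries.coeff_prod]
  simp [Finset.finsuppAntidiag]

/-- The compositions of `2k` with prescribed parities. -/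
theorem card_piAntidiag_filter_natCast_eq {ι : Type*} [Fintype ι] [DecidableEq ι] (c : ι → ZMod 2)
    {w : ℕ} (hw : ∑ i, (c i).val = 2 * w) (k : ℕ) :
    ((Finset.piAntidiag (Finset.univ : Finset ι) (2 * k)).filter
      fun a => (fun i => (a i : ZMod 2)) = c).card =
        if w ≤ k then (Finset.piAntidiag (Finset.univ : Finset ι) (k - w)).card else 0 := by
  have hdecomp : ∀ a : ι → ℕ, (fun i => (a i : ZMod 2)) = c →
      ∀ i, a i = 2 * (a i / 2) + (c i).val := by
    rintro a rfl i
    simp only [ZMod.val_natCast]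
    omega
  have hsum : ∀ a : ι → ℕ, (fun i => (a i : ZMod 2)) = c → ∑ i, a i = 2 * ∑ i, a i / 2 + 2 * w := by
    intro a ha
    rw [← hw, Finset.mul_sum, ← Finset.sum_add_distrib]
    exact Finset.sum_congr rfl fun i _ => hdecomp a ha i
  split_ifs with hk
  -- Writing `a = 2b + c` with the residues `c` lifted to `{0, 1}`, the map `a ↦ b` is a bijection
  -- onto the compositions of `k - w`.
  · refine Finset.card_nbij' (fun a i => a i / 2) (fun b i => 2 * b i + (c i).val) ?_ ?_ ?_ ?_
    · intro a ha
      simp only [Finset.coe_filter, Finset.mem_piAntidiag, Finset.mem_univ, implies_true, and_true,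
        Set.mem_ofPred_eq, Finset.mem_coe] at ha ⊢
      have := (hsum a ha.2).symm.trans ha.1
      omega
    · intro b hb
      simp only [Finset.coe_filter, Finset.mem_piAntidiag, Finset.mem_univ, implies_true, and_true,
        Set.mem_ofPred_eq, Finset.mem_coe] at hb ⊢
      refine ⟨?_, funext fun i => ?_⟩
      · rw [Finset.sum_add_distrib, ← Finset.mul_sum, hb, hw]
        omega
      · push_cast
        rw [ZMod.natCast_zmod_val, show (2 : ZMod 2) = 0 from rfl, zero_mul, zero_add]
    · intro a ha
      simp only [Finset.coe_filter, Set.mem_ofPred_eq] at ha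
      exact funext fun i => (hdecomp a ha.2 i).symm
    · intro b _
      funext i
      have := ZMod.val_lt (c i)
      simp only
      omega
  · rw [Finset.card_eq_zero, Finset.filter_eq_empty_iff]
    intro a ha hac
    have h := hsum a hac
    rw [(Finset.mem_piAntidiag.mp ha).1] at h
    omega

/-- The `k`-th dilates correspond under `x ↦ xU + kw`, which preserves the lattice. -/
theorem UnimodularEquiv.latticeCount_eq {d : ℕ} {P Q : Set (Fin d → ℝ)} (h : UnimodularEquiv P Q)
    (k : ℕ) : latticeCount P k = latticeCount Q k := by
  obtain ⟨U, w, hU, rfl⟩ := h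
  have hmul : U * U⁻¹ = 1 := mul_nonsing_inv U hU
  have hmul' : U⁻¹ * U = 1 := nonsing_inv_mul U hU
  let A : (Fin d → ℝ) → Fin d → ℝ :=
    fun x => x ᵥ* U.map (Int.cast : ℤ → ℝ) + intVec ((k : ℤ) • w)
  have hw : intVec ((k : ℤ) • w) = (k : ℝ) • intVec w := by ext; simp [intVec]
  have hA : Function.Injective A := by
    intro x y hxy
    have h := congrArg (fun z => z ᵥ* U⁻¹.map (Int.cast : ℤ → ℝ)) (add_right_cancel hxy)
    simp only [vecMul_vecMul, ← map_cast_mul, hmul] at h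
    simpa using h
  have hlat : ∀ x, A x ∈ intLattice d → x ∈ intLattice d := by
    rintro x ⟨z, hz⟩
    refine ⟨(z - (k : ℤ) • w) ᵥ* U⁻¹, hA ?_⟩
    simp only [A] at hz ⊢
    rw [intVec_vecMul, vecMul_vecMul, hmul', vecMul_one, ← intVec_add, sub_add_cancel, hz]
  rw [latticeCount, latticeCount, ← Set.ncard_image_of_injective _ hA]
  congr 1
  ext y
  constructor
  · rintro ⟨_, ⟨⟨x, hx, rfl⟩, z, hz⟩, rfl⟩
    have hz : intVec z = (k : ℝ) • x := hz
    refine ⟨⟨_, ⟨x, hx, rfl⟩, ?_⟩, z ᵥ* U + (k : ℤ) • w, ?_⟩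
    · simp only [A, hw, smul_add, smul_vecMul]
    · change _ = ((k : ℝ) • x) ᵥ* _ + _
      rw [← hz, intVec_vecMul, intVec_add]
  · rintro ⟨⟨_, ⟨x, hx, rfl⟩, rfl⟩, hy⟩
    have e : A ((k : ℝ) • x) = (k : ℝ) • (x ᵥ* U.map (Int.cast : ℤ → ℝ) + intVec w) := by
      simp only [A, hw, smul_add, smul_vecMul]
    refine ⟨(k : ℝ) • x, ⟨⟨x, hx, rfl⟩, hlat _ ?_⟩, e⟩
    rw [e]
    exact hy

theorem UnimodularEquiv.hStar_eq {d : ℕ} {P Q : Set (Fin d → ℝ)} (h : UnimodularEquiv P Q) :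
    hStar P = hStar Q := by
  simp only [hStar, ehrhartSeries, h.latticeCount_eq]

namespace LatticeSimplex

/-- The linear relations modulo `2` between the vectors `(v_i, 1)`. -/
def relationCode {d : ℕ} (Δ : LatticeSimplex d) : Finset (Fin (d + 1) → ZMod 2) :=
  Finset.univ.filter fun c => ∀ k, ∑ i, c i * Δ.rowModTwo i k = 0

theorem mem_relationCode {d : ℕ} (Δ : LatticeSimplex d) {c : Fin (d + 1) → ZMod 2} :
    c ∈ Δ.relationCode ↔ ∀ k, ∑ i, c i * Δ.rowModTwo i k = 0 := by
  simp [relationCode]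

/-- A lattice point of `kΔ` is recorded by its doubled barycentric coordinates, natural numbers with
sum `2k`. Such a tuple comes from a lattice point exactly when its residues are a relation among the
rows modulo 2. -/
theorem latticeCount_eq_card {d : ℕ} (Δ : LatticeSimplex d)
    {B : Matrix (Fin (d + 1)) (Fin (d + 1)) ℤ} (hB : Δ.homMatrix * B = (2 : ℤ) • 1) {k : ℕ}
    (hk : 0 < k) :
    latticeCount Δ.polytope k =
      ((Finset.piAntidiag (Finset.univ : Finset (Fin (d + 1))) (2 * k)).filter
        fun a => (fun i => (a i : ZMod 2)) ∈ Δ.relationCode).card := by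
  have hk' : (0 : ℝ) < k := by exact_mod_cast hk
  let g : (Fin (d + 1) → ℕ) → Fin d → ℝ := fun a => ∑ i, ((a i : ℝ) / 2) • intVec (Δ.vertex i)
  set T := (Finset.piAntidiag (Finset.univ : Finset (Fin (d + 1))) (2 * k)).filter
    fun a => (fun i => (a i : ZMod 2)) ∈ Δ.relationCode with hT
  have hbary : ∀ a ∈ T, Δ.bary k (g a) = fun i => (a i : ℝ) / 2 := by
    intro a ha
    rw [hT, Finset.mem_filter, Finset.mem_piAntidiag] at ha
    have h := Δ.bary_sum fun i => (a i : ℝ) / 2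
    rwa [← Finset.sum_div, ← Nat.cast_sum, ha.1.1, Nat.cast_mul, Nat.cast_ofNat,
      mul_div_cancel_left₀ _ (two_ne_zero' ℝ)] at h
  have hinj : Set.InjOn g T := by
    intro a ha b hb hab
    have h := hbary a ha
    rw [hab, hbary b hb] at h
    funext i
    have h1 := congrFun h i
    have h2 : (a i : ℝ) = b i := by linarith
    exact_mod_cast h2
  rw [latticeCount, ← Set.ncard_coe_finset, ← hinj.ncard_image]
  congr 1
  ext x
  constructor
  · rintro ⟨hx, z, rfl⟩
    have hnn := (Δ.mem_smul_polytope hk').mp hx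
    have hint := Δ.two_mul_bary_int hB k z
    set n : Fin (d + 1) → ℤ := homVec z (k : ℤ) ᵥ* B with hn
    rw [Int.cast_natCast] at hint
    have hn0 : ∀ i, 0 ≤ n i := by
      intro i
      have h1 : (0 : ℝ) ≤ (n i : ℝ) := by rw [← hint i]; linarith [hnn i]
      exact_mod_cast h1
    have hcast : ∀ i, (((n i).toNat : ℕ) : ℤ) = n i := fun i => Int.toNat_of_nonneg (hn0 i)
    have hcastR : ∀ i, (((n i).toNat : ℕ) : ℝ) = n i := fun i => by exact_mod_cast hcast i
    have hrel : ∀ l, ∑ i, n i * Δ.homMatrix i l = 2 * homVec z (k : ℤ) l := by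
      intro l
      have h := congrFun (Δ.bary_vecMul k (intVec z)) l
      rw [show homVec (intVec z) (k : ℝ) = intVec (homVec z (k : ℤ)) by
        rw [← homVec_intVec, Int.cast_natCast]] at h
      have h1 : ∑ i, (n i : ℝ) * Δ.homMatrix i l = 2 * (homVec z (k : ℤ) l : ℤ) := by
        change _ = ((homVec z (k : ℤ) l : ℤ) : ℝ) at h
        rw [← h, vecMul, dotProduct, Finset.mul_sum]
        refine Finset.sum_congr rfl fun i _ => ?_
        rw [← hint i, realMatrix, map_apply]
        ring
      exact_mod_cast h1
    refine ⟨fun i => (n i).toNat, ?_, ?_⟩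
    · rw [hT, Finset.mem_coe, Finset.mem_filter, Finset.mem_piAntidiag, mem_relationCode]
      refine ⟨⟨?_, by simp⟩, fun l => ?_⟩
      · have h := hrel (Fin.last d)
        simp only [homMatrix_last, mul_one, homVec_last] at h
        have h1 : ∑ i, (((n i).toNat : ℕ) : ℤ) = 2 * k := by simpa only [hcast] using h
        exact_mod_cast h1
      · have h := congrArg (Int.cast : ℤ → ZMod 2) (hrel l)
        push_cast at h
        rw [show (2 : ZMod 2) = 0 from rfl, zero_mul] at h
        rw [← h]
        refine Finset.sum_congr rfl fun i _ => ?_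
        have hc : (((n i).toNat : ℕ) : ZMod 2) = (n i : ZMod 2) := by
          rw [← Int.cast_natCast, hcast]
        simp only [hc, rowModTwo]
    · simp only [g, hcastR, ← hint]
      rw [← Δ.sum_bary_smul k (intVec z)]
      refine Finset.sum_congr rfl fun i _ => ?_
      rw [Δ.sum_bary_smul, mul_div_cancel_left₀ _ (two_ne_zero' ℝ)]
  · rintro ⟨a, ha, rfl⟩
    refine ⟨(Δ.mem_smul_polytope hk').mpr fun i => ?_, mem_intLattice.mpr fun l => ?_⟩
    · rw [hbary a ha]
      positivity
    · rw [hT, Finset.mem_coe, Finset.mem_filter, mem_relationCode] at ha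
      have h := ha.2 l.castSucc
      have h1 : ((∑ i, (a i : ℤ) * Δ.vertex i l : ℤ) : ZMod 2) = 0 := by
        push_cast
        simpa [rowModTwo] using h
      obtain ⟨z, hz⟩ := (ZMod.intCast_zmod_eq_zero_iff_dvd _ 2).mp h1
      refine ⟨z, ?_⟩
      have h2 : ∑ i, (a i : ℝ) * Δ.vertex i l = 2 * z := by exact_mod_cast hz
      have h3 : g a l = (∑ i, (a i : ℝ) * Δ.vertex i l) / 2 := by
        simp only [g, Finset.sum_apply, Pi.smul_apply, smul_eq_mul, intVec, Finset.sum_div]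
        exact Finset.sum_congr rfl fun i _ => by ring
      rw [h3, h2]
      ring

theorem even_weight {d : ℕ} (Δ : LatticeSimplex d) {c : Fin (d + 1) → ZMod 2}
    (hc : c ∈ Δ.relationCode) : ∑ i, (c i).val = 2 * ((∑ i, (c i).val) / 2) := by
  have h := Δ.mem_relationCode.mp hc (Fin.last d)
  simp only [rowModTwo_last, mul_one] at h
  have h1 : ((∑ i, (c i).val : ℕ) : ZMod 2) = 0 := by
    push_cast
    simpa using h
  rw [ZMod.natCast_eq_zero_iff] at h1
  omega

/-- If twice the barycentric coordinates of lattice points are integers, the `h^*`-polynomial is the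
weight enumerator of the code of relations modulo `2`. -/
theorem hStar_eq_sum {d : ℕ} (Δ : LatticeSimplex d) {B : Matrix (Fin (d + 1)) (Fin (d + 1)) ℤ}
    (hB : Δ.homMatrix * B = (2 : ℤ) • 1) :
    hStar Δ.polytope =
      ∑ c ∈ Δ.relationCode, (PowerSeries.X : PowerSeries ℤ) ^ ((∑ i, (c i).val) / 2) := by
  have hE : ehrhartSeries Δ.polytope =
      (∑ c ∈ Δ.relationCode, (PowerSeries.X : PowerSeries ℤ) ^ ((∑ i, (c i).val) / 2)) *
        (PowerSeries.mk 1) ^ (d + 1) := by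
    ext k
    have hcoeff : (if k = 0 then 1 else (latticeCount Δ.polytope k : ℤ)) =
        (((Finset.piAntidiag (Finset.univ : Finset (Fin (d + 1))) (2 * k)).filter
          fun a => (fun i => (a i : ZMod 2)) ∈ Δ.relationCode).card : ℤ) := by
      split_ifs with hk
      · subst hk
        have h0 : (fun _ : Fin (d + 1) => (0 : ZMod 2)) ∈ Δ.relationCode := by
          rw [mem_relationCode]
          simp
        simp [Finset.filter_singleton, h0]
      · rw [Δ.latticeCount_eq_card hB (Nat.pos_of_ne_zero hk)]
    rw [ehrhartSeries, PowerSeries.coeff_mk, hcoeff, Finset.sum_mul, map_sum]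
    -- Tuples are grouped by their residues `c`. The group of `c` contributes the coefficient of
    -- `t^(|c|/2) / (1 - t)^(d+1)`, where `|c|` is the weight.
    have hmaps : Set.MapsTo (fun (a : Fin (d + 1) → ℕ) i => (a i : ZMod 2))
        ((Finset.piAntidiag (Finset.univ : Finset (Fin (d + 1))) (2 * k)).filter
          fun a => (fun i => (a i : ZMod 2)) ∈ Δ.relationCode : Finset (Fin (d + 1) → ℕ))
        Δ.relationCode := fun a ha => (Finset.mem_filter.mp ha).2
    rw [Finset.card_eq_sum_card_fiberwise hmaps]
    push_cast
    refine Finset.sum_congr rfl fun c hc => ?_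
    have hcard := PowerSeries.coeff_mk_one_pow_card (ι := Fin (d + 1)) (k - (∑ i, (c i).val) / 2)
    rw [Fintype.card_fin] at hcard
    rw [PowerSeries.coeff_X_pow_mul', hcard, Finset.filter_filter]
    have hfil : ((Finset.piAntidiag (Finset.univ : Finset (Fin (d + 1))) (2 * k)).filter
        fun a => (fun i => (a i : ZMod 2)) ∈ Δ.relationCode ∧ (fun i => (a i : ZMod 2)) = c) =
        (Finset.piAntidiag (Finset.univ : Finset (Fin (d + 1))) (2 * k)).filter
          fun a => (fun i => (a i : ZMod 2)) = c :=
      Finset.filter_congr fun a _ => ⟨fun h => h.2, fun h => ⟨h ▸ hc, h⟩⟩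
    rw [hfil, card_piAntidiag_filter_natCast_eq c (Δ.even_weight hc)]
    split_ifs <;> simp
  rw [hStar, hE, mul_left_comm, ← mul_pow, mul_comm (1 - PowerSeries.X),
    PowerSeries.mk_one_mul_one_sub_eq_one, one_pow, mul_one]

theorem hStar_tableSimplex (t : Fin 6) :
    hStar (tableSimplex t).polytope = (tableHStar t : PowerSeries ℤ) := by
  obtain ⟨B, hB⟩ := (isHalfIntegral_tableSimplex t).1
  rw [(tableSimplex t).hStar_eq_sum hB]
  have hcount : ∀ t (w : Fin 4), ((tableSimplex t).relationCode.filter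
      fun c => (∑ i, (c i).val) / 2 = (w : ℕ)).card =
        (![![1, 0, 0, 1], ![1, 1, 1, 1], ![1, 3, 3, 1], ![1, 3, 3, 1], ![1, 7, 7, 1],
          ![1, 15, 15, 1]] : Fin 6 → Fin 4 → ℕ) t w := by
    decide +kernel
  have hmaps : ∀ c ∈ (tableSimplex t).relationCode, (∑ i, (c i).val) / 2 ∈ Finset.range 4 := by
    intro c _
    have h : ∑ i, (c i).val ≤ ∑ i : Fin 6, 1 :=
      Finset.sum_le_sum fun i _ => Nat.lt_succ_iff.mp (ZMod.val_lt (c i))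
    simp only [Finset.sum_const, Finset.card_univ, Fintype.card_fin, smul_eq_mul] at h
    rw [Finset.mem_range]
    omega
  rw [← Finset.sum_fiberwise_of_maps_to hmaps]
  have hinner : ∀ w, ∑ c ∈ (tableSimplex t).relationCode with (∑ i, (c i).val) / 2 = w,
      (PowerSeries.X : PowerSeries ℤ) ^ ((∑ i, (c i).val) / 2) =
        ((tableSimplex t).relationCode.filter fun c => (∑ i, (c i).val) / 2 = w).card •
          (PowerSeries.X : PowerSeries ℤ) ^ w := by
    intro w
    rw [← Finset.sum_const]
    exact Finset.sum_congr rfl fun c hc => by rw [(Finset.mem_filter.mp hc).2]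
  have h0 := hcount t 0
  have h1 := hcount t 1
  have h2 := hcount t 2
  have h3 := hcount t 3
  simp only [Fin.val_zero, Fin.val_one, Fin.val_two, show ((3 : Fin 4) : ℕ) = 3 from rfl]
    at h0 h1 h2 h3
  simp only [hinner, Finset.sum_range_succ, Finset.sum_range_zero, h0, h1, h2, h3, zero_add]
  have hnum : ∀ n : ℕ, [n.AtLeastTwo] →
      ((ofNat(n) : Polynomial ℤ) : PowerSeries ℤ) = ofNat(n) := fun n _ =>
    map_ofNat Polynomial.coeToPowerSeries.ringHom n
  fin_cases t <;> simp [tableHStar, hnum]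

end LatticeSimplex

/-! ### The classification -/

theorem theorem4p4 :
    -- each of the six listed simplices occurs, with the listed graph and `h^*`-polynomial
    (∀ i : Fin 6,
      (LatticeSimplex.tableSimplex i).IsNonpyramidalGorensteinDegreeThree ∧
      Nonempty ((LatticeSimplex.tableSimplex i).graph ≃g LatticeSimplex.tableGraph i) ∧
      hStar (LatticeSimplex.tableSimplex i).polytope =
        (LatticeSimplex.tableHStar i : PowerSeries ℤ)) ∧
    -- every such simplex is equivalent to exactly one of them, namely the one with its graph,
    -- and has the listed `h^*`-polynomial
    (∀ Δ : LatticeSimplex 5, Δ.IsNonpyramidalGorensteinDegreeThree →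
      (∃! i : Fin 6, UnimodularEquiv Δ.polytope (LatticeSimplex.tableSimplex i).polytope) ∧
      ∀ i : Fin 6,
        (UnimodularEquiv Δ.polytope (LatticeSimplex.tableSimplex i).polytope ↔
          Nonempty (Δ.graph ≃g LatticeSimplex.tableGraph i)) ∧
        (UnimodularEquiv Δ.polytope (LatticeSimplex.tableSimplex i).polytope →
          hStar Δ.polytope = (LatticeSimplex.tableHStar i : PowerSeries ℤ))) ∧
    -- there are exactly six unimodular equivalence classes
    Nat.card (Quotient LatticeSimplex.degreeThreeSetoid) = 6 := by
  have hex : ∀ Δ : LatticeSimplex 5, Δ.IsNonpyramidalGorensteinDegreeThree → ∀ i,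
      (UnimodularEquiv Δ.polytope (LatticeSimplex.tableSimplex i).polytope ↔
        Nonempty (Δ.graph ≃g LatticeSimplex.tableGraph i)) := by
    intro Δ hΔ i
    obtain ⟨e⟩ := LatticeSimplex.nonempty_tableSimplex_graph_iso i
    constructor
    · intro h
      obtain ⟨e'⟩ := LatticeSimplex.nonempty_graph_iso_of_unimodularEquiv h
      exact ⟨e'.trans e⟩
    · rintro ⟨e'⟩
      exact LatticeSimplex.unimodularEquiv_of_graph_iso
        (LatticeSimplex.isHalfIntegral_of_isNonpyramidal hΔ)
        (LatticeSimplex.isHalfIntegral_tableSimplex i) (e'.trans e.symm)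
  have hunique : ∀ Δ : LatticeSimplex 5, Δ.IsNonpyramidalGorensteinDegreeThree →
      ∃! i, UnimodularEquiv Δ.polytope (LatticeSimplex.tableSimplex i).polytope := by
    intro Δ hΔ
    obtain ⟨i, ⟨e⟩⟩ := LatticeSimplex.exists_graph_iso_tableGraph
      (LatticeSimplex.isHalfIntegral_of_isNonpyramidal hΔ)
    refine ⟨i, (hex Δ hΔ i).mpr ⟨e⟩, fun j hj => ?_⟩
    obtain ⟨e'⟩ := (hex Δ hΔ j).mp hj
    exact LatticeSimplex.eq_of_tableGraph_iso (e'.symm.trans e)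
  have htable : ∀ i, (LatticeSimplex.tableSimplex i).IsNonpyramidalGorensteinDegreeThree :=
    fun i => LatticeSimplex.isNonpyramidal_of_isHalfIntegral
      (LatticeSimplex.isHalfIntegral_tableSimplex i)
  refine ⟨fun i => ⟨htable i, LatticeSimplex.nonempty_tableSimplex_graph_iso i,
    LatticeSimplex.hStar_tableSimplex i⟩, fun Δ hΔ => ⟨hunique Δ hΔ, fun i => ⟨hex Δ hΔ i,
      fun h => h.hStar_eq.trans (LatticeSimplex.hStar_tableSimplex i)⟩⟩, ?_⟩
  let F : Fin 6 → Quotient LatticeSimplex.degreeThreeSetoid := fun i => ⟦⟨_, htable i⟩⟧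
  have hF : Function.Bijective F := by
    constructor
    · intro i j hij
      exact (hunique _ (htable i)).unique (UnimodularEquiv.refl _) (Quotient.exact hij)
    · intro q
      induction q using Quotient.inductionOn with
      | h Δ =>
        obtain ⟨i, hi, -⟩ := hunique Δ.1 Δ.2
        exact ⟨i, Quotient.sound hi.symm⟩
  rw [← Nat.card_eq_of_bijective F hF, Nat.card_fin]
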